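/- Let $M$ be a smooth $n$-dimensional manifold and let $\mathcal A\subseteq TM$ be an open set of nonzero tangent vectors that is stable under multiplication by positive numbers (for instance $\mathcal A=TM\setminus 0$). A Finsler structure on $\mathcal A$ is a smooth function $L:\mathcal A\to(0,\infty)$, positively homogeneous of degree one on the fibres, such that the matrix $g_{ij}=\frac12\dot\partial_i\dot\partial_j L^2$ is nondegenerate on $\mathcal A$ (in particular, it may be positive definite). Here $(x^i,y^i)$ are the coordinates on $TM$ induced by a chart of $M$, $\partial_i=\partial/\partial x^i$, $\dot\partial_i=\partial/\partial y^i$, and repeated indices are summed. Write $(g^{ij})=(g_{ij})^{-1}$ and $$\gamma^i_{jk}=\tfrac12 g^{ir}(\partial_jg_{kr}+\partial_kg_{jr}-\partial_rg_{jk}),\quad G^i=\tfrac12\gamma^i_{jk}y^jy^k,\quad N^i_j=\dot\partial_jG^i,\quad \delta_i=\partial_i-N^r_i\dot\partial_r,$$ $$\Gamma^i_{jk}=\tfrac12 g^{ir}(\delta_jg_{kr}+\delta_kg_{jr}-\delta_rg_{jk}),\quad y_i=g_{ij}y^j,\quad h_{ij}=L\,\dot\partial_i\dot\partial_jL,\quad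 C_{ijk}=\tfrac12\dot\partial_kg_{ij};$$ the $\Gamma^i_{jk}$ are the coefficients of the Cartan connection of $L$. Let $L$ be a Finsler structure on $\mathcal A$, $\sigma$ a smooth function on $M$, $\beta=b_i(x)y^i$ a smooth differential one-form on $M$, and let $f$ be a smooth function, positively homogeneous of degree one, on an open cone of $\mathbb R^2$ that contains all values $(e^\sigma L,\beta)$ on $\mathcal A$. Assume that the generalized $\beta$-conformal change $\overline L=f(e^{\sigma}L,\beta)$ is again a Finsler structure on $\mathcal A$. The subscripts $1$ and $2$ of $f$ denote partial derivatives with respect to the first and second argument, evaluated at $(e^\sigma L,\beta)$; assume $f_1\neq0$ on $\mathcal A$. Put $\sigma_i=\partial_i\sigma$, $\sigma^i=g^{ij}\sigma_j$, $b^i=g^{ij}b_j$, $b^2=b^ib_i$, $m_i=b_i-(\beta/L^2)y_i$, $m^2=g^{ij}m_im_j$, $b_{i|k}=\partial_kb_i-b_r\Gamma^r_{ik}$, $\sigma_\beta=\sigma_rb^r$, and $$q=ff_2,\quad p=ff_1/L,\quad q_0=ff_{22},\quad p_0=f_2^2+q_0,\quad q_{-1}=ff_{12}/L,\quad p_{-1}=q_{-1}+pf_2/f,$$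 $$q_{-2}=f(e^\sigma f_{11}-f_1/L)/L^2,\quad p_{-2}=q_{-2}+e^\sigma p^2/f^2,\quad p_{02}=\partial p_0/\partial\beta,\quad \varepsilon=f^2(e^\sigma p+m^2q_0)/L^2,$$ where in $\partial p_0/\partial\beta$ the quantity $p_0=f_2^2+ff_{22}$ is regarded as a function of the two arguments of $f$, $$s_0=\frac{e^{-\sigma}f^2q_0}{\varepsilon pL^2},\qquad s_{-1}=\frac{p_{-1}f^2}{p\varepsilon L^2},\qquad s_{-2}=\frac{p_{-1}(e^\sigma m^2pL^2-b^2f^2)}{\varepsilon p\beta L^2},$$ where at points with $\beta=0$ the last expression (a removable singularity) stands for $-p_{-1}q\,m^2/(\varepsilon pL^2)$. Let $$E_{ij}=\tfrac12(b_{i|j}+b_{j|i}),\quad F_{ij}=\tfrac12(b_{i|j}-b_{j|i}),\quad B_{ij}=\tfrac12(e^\sigma p_{-1}h_{ij}+p_{02}m_im_j),\quad Q_i=e^\sigma p_{-1}y_i+p_0b_i,$$ $$V_{ijk}=\tfrac12e^\sigma p_{-1}(h_{ij}m_k+h_{jk}m_i+h_{ki}m_j)+\tfrac12p_{02}m_im_jm_k,$$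 $$K_{ij}=e^\sigma(2p-\beta p_{-1})g_{ij}-\beta p_{02}b_ib_j+\Big(e^\sigma p_{-1}+\frac{\beta^2}{L^2}p_{02}\Big)(b_iy_j+b_jy_i)+\Big(e^\sigma p_{-2}-\frac{\beta^3}{L^4}p_{02}\Big)y_iy_j.$$ In $E_{ij}$, $F_{ij}$, $b_{i|j}$ and $\sigma_i$ an index $0$ denotes contraction with $y$ (e.g. $b_{0|k}=b_{i|k}y^i$, $F_{i0}=F_{ij}y^j$, $\sigma_0=\sigma_iy^i$); $F^i_0=g^{ij}F_{j0}$, $F_{\beta0}=F_{r0}b^r$. Define $$\begin{aligned}D^i={}&\frac{\sigma_0}{2p}\Big\{\big[2p-\beta p_{-1}-e^\sigma p^2L^2s_{-2}-ps_{-1}(2e^\sigma p\beta+e^\sigma p_{-1}L^2m^2)\big]y^i-2e^\sigma p^2\beta s_0b^i\Big\}\\&+\frac qpe^{-\sigma}F^i_0-\tfrac12L^2\sigma^i+\tfrac12\big(e^\sigma pE_{00}-2qF_{\beta0}+e^\sigma pL^2\sigma_\beta\big)(s_0b^i+s_{-1}y^i),\end{aligned}$$ $$\begin{aligned}A_{ij}={}&E_{00}B_{ij}+F_{i0}Q_j+qF_{ij}+E_{j0}Q_i-2(e^\sigma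 pC_{sij}+V_{sij})D^s\\&+\tfrac12\sigma_0\big[2e^\sigma pg_{ij}+2e^\sigma p_{-1}m_jy_i-2\beta B_{ij}+e^\sigma p_{-1}(b_iy_j-b_jy_i)\big]\\&-\tfrac12\sigma_i(e^\sigma L^2p_{-1}m_j+2e^\sigma py_j)+\tfrac12\sigma_j(2e^\sigma py_i+e^\sigma L^2p_{-1}m_i),\end{aligned}$$ $$D^i_j=\frac{e^{-\sigma}}pg^{li}A_{lj}-(s_0b^i+s_{-1}y^i)A_{rj}b^r-(qb_{0|j}+e^\sigma pL^2\sigma_j)(s_{-1}b^i+s_{-2}y^i),$$ and $\Theta_{(j,k,r)}\{X_{jkr}\}=X_{jkr}-X_{krj}-X_{rjk}$. Then, in every chart and at every point of $\mathcal A$, the Cartan connection coefficients of $\overline L$ are $$\overline\Gamma^i_{jk}=\Gamma^i_{jk}+D^i_{jk},$$ where $$\begin{aligned}D^i_{jk}={}&\overline g^{ir}\Big[F_{rk}Q_j+F_{rj}Q_k+E_{jk}Q_r\\&+\tfrac12\Theta_{(j,k,r)}\big\{2e^\sigma pC_{jkm}D^m_r+2V_{jkm}D^m_r-K_{jk}\sigma_r-2B_{jk}b_{0|r}\big\}\Big],\end{aligned}$$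 and the inverse metric of $\overline L$ is $$\overline g^{ir}=\frac{e^{-\sigma}}p\,g^{ir}-(s_0b^i+s_{-1}y^i)b^r-(s_{-1}b^i+s_{-2}y^i)y^r .$$ -/

import Mathlib

open scoped Manifold ContDiff

noncomputable section

namespace GenBetaConformal

/-- The coordinate space `ℝⁿ`. -/
abbrev Coord (n : ℕ) : Type := EuclideanSpace ℝ (Fin n)

/-- The `i`-th coordinate vector of `ℝⁿ`. -/
def basisVec {n : ℕ} (i : Fin n) : Coord n := EuclideanSpace.single i (1 : ℝ)

/-- A real function of the position `x` and of the supporting element `y`, in local coordinates. -/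
abbrev LocFun (n : ℕ) : Type := Coord n → Coord n → ℝ

section Derivatives

variable {n : ℕ}

/-- `∂ᵢ F`, the partial derivative with respect to `xⁱ`. -/
def dx (i : Fin n) (F : LocFun n) : LocFun n :=
  fun x y => fderiv ℝ (fun x' => F x' y) x (basisVec i)

/-- `∂̇ᵢ F`, the partial derivative with respect to `yⁱ`. -/
def dy (i : Fin n) (F : LocFun n) : LocFun n :=
  fun x y => fderiv ℝ (fun y' => F x y') y (basisVec i)

end Derivatives

/-! ## Finsler geometry in local coordinates

In this section `L` is the expression of a fundamental function in local coordinates. -/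

section Finsler

variable {n : ℕ}

/-- `g_{ij} = ½ ∂̇ᵢ ∂̇ⱼ L²`. -/
def g (L : LocFun n) (i j : Fin n) : LocFun n :=
  fun x y => (1 / 2) * dy i (dy j (fun x y => L x y ^ 2)) x y

/-- The matrix `(g_{ij})` at `(x, y)`. -/
def gMat (L : LocFun n) (x y : Coord n) : Matrix (Fin n) (Fin n) ℝ :=
  Matrix.of fun i j => g L i j x y

/-- `g^{ij}`, the entries of the inverse matrix of `(g_{ij})`. -/
def gInv (L : LocFun n) (i j : Fin n) : LocFun n :=
  fun x y => (gMat L x y)⁻¹ i j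

/-- `y_i = g_{ij} y^j`. -/
def yLow (L : LocFun n) (i : Fin n) : LocFun n :=
  fun x y => ∑ j, g L i j x y * y j

/-- The angular metric tensor `h_{ij} = L ∂̇ᵢ ∂̇ⱼ L`. -/
def h (L : LocFun n) (i j : Fin n) : LocFun n :=
  fun x y => L x y * dy i (dy j L) x y

/-- The Cartan tensor `C_{ijk} = ½ ∂̇ₖ g_{ij}`. -/
def C (L : LocFun n) (i j k : Fin n) : LocFun n :=
  fun x y => (1 / 2) * dy k (g L i j) x y

/-- The Christoffel symbols `γ^i_{jk}` with respect to `∂ᵢ`. -/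
def gammaSym (L : LocFun n) (i j k : Fin n) : LocFun n :=
  fun x y => (1 / 2) * ∑ r, gInv L i r x y *
    (dx j (g L k r) x y + dx k (g L j r) x y - dx r (g L j k) x y)

/-- The canonical spray `G^i = ½ γ^i_{jk} y^j y^k`. -/
def G (L : LocFun n) (i : Fin n) : LocFun n :=
  fun x y => (1 / 2) * ∑ j, ∑ k, gammaSym L i j k x y * y j * y k

/-- The Cartan (Barthel) nonlinear connection `N^i_j = ∂̇ⱼ G^i`. -/
def N (L : LocFun n) (i j : Fin n) : LocFun n := dy j (G L i)

/-- `δᵢ F = ∂ᵢ F - N^r_i ∂̇ᵣ F`. -/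
def delta (L : LocFun n) (i : Fin n) (F : LocFun n) : LocFun n :=
  fun x y => dx i F x y - ∑ r, N L r i x y * dy r F x y

/-- The coefficients `Γ^i_{jk}` of the Cartan connection (the Christoffel symbols with respect
to `δᵢ`). -/
def Gam (L : LocFun n) (i j k : Fin n) : LocFun n :=
  fun x y => (1 / 2) * ∑ r, gInv L i r x y *
    (delta L j (g L k r) x y + delta L k (g L j r) x y - delta L r (g L j k) x y)

/-- The horizontal Cartan covariant derivative `X_{i|k} = δₖ X_i - X_r Γ^r_{ik}` of a covector
field `X_i(x, y)`. -/
def hCov (L : LocFun n) (X : Fin n → LocFun n) (i k : Fin n) : LocFun n :=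
  fun x y => delta L k (X i) x y - ∑ r, X r x y * Gam L r i k x y

end Finsler

/-! ## Partial derivatives of a function of two real variables -/

/-- `∂f/∂u` for `f = f(u, v)`. -/
def D1 (f : ℝ → ℝ → ℝ) : ℝ → ℝ → ℝ := fun u v => deriv (fun s => f s v) u

/-- `∂f/∂v` for `f = f(u, v)`. -/
def D2 (f : ℝ → ℝ → ℝ) : ℝ → ℝ → ℝ := fun u v => deriv (fun t => f u t) v

/-! ## The change in local coordinates -/

/-- The data of a generalized `β`-conformal change `L ↦ f(e^σ L, β)` in local coordinates, where
`β = b_i(x) y^i`. -/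
structure LocalChange (n : ℕ) where
  L : LocFun n
  σ : Coord n → ℝ
  b : Fin n → Coord n → ℝ
  f : ℝ → ℝ → ℝ

namespace LocalChange

variable {n : ℕ} (T : LocalChange n)

/-- `β(x, y) = b_i(x) y^i`. -/
def β : LocFun n := fun x y => ∑ i, T.b i x * y i

/-- The value at `(e^σ L, β)` of a function of two real variables. -/
def ev (F : ℝ → ℝ → ℝ) : LocFun n :=
  fun x y => F (Real.exp (T.σ x) * T.L x y) (T.β x y)

/-- `f(e^σ L, β)`. -/
def f0 : LocFun n := T.ev T.f
def f1 : LocFun n := T.ev (D1 T.f)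
def f2 : LocFun n := T.ev (D2 T.f)
def f11 : LocFun n := T.ev (D1 (D1 T.f))
def f12 : LocFun n := T.ev (D2 (D1 T.f))
def f22 : LocFun n := T.ev (D2 (D2 T.f))

/-- `e^σ`. -/
def eσ : LocFun n := fun x _ => Real.exp (T.σ x)

/-! Below, a trailing `m1` or `m2` in a name stands for the subscript `-1` or `-2`. -/

/-- `q = f f₂`. -/
def q : LocFun n := fun x y => T.f0 x y * T.f2 x y

/-- `p = f f₁ / L`. -/
def p : LocFun n := fun x y => T.f0 x y * T.f1 x y / T.L x y

/-- `q₀ = f f₂₂`. -/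
def q0 : LocFun n := fun x y => T.f0 x y * T.f22 x y

/-- `p₀ = f₂² + q₀`. -/
def p0 : LocFun n := fun x y => T.f2 x y ^ 2 + T.q0 x y

/-- `q₋₁ = f f₁₂ / L`. -/
def qm1 : LocFun n := fun x y => T.f0 x y * T.f12 x y / T.L x y

/-- `p₋₁ = q₋₁ + p f₂ / f`. -/
def pm1 : LocFun n := fun x y => T.qm1 x y + T.p x y * T.f2 x y / T.f0 x y

/-- `q₋₂ = f (e^σ f₁₁ - f₁ / L) / L²`. -/
def qm2 : LocFun n := fun x y =>
  T.f0 x y * (T.eσ x y * T.f11 x y - T.f1 x y / T.L x y) / T.L x y ^ 2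

/-- `p₋₂ = q₋₂ + e^σ p² / f²`. -/
def pm2 : LocFun n := fun x y =>
  T.qm2 x y + T.eσ x y * T.p x y ^ 2 / T.f0 x y ^ 2

/-- `p₀₂ = ∂p₀/∂β`, where `p₀ = f₂² + f f₂₂` is regarded as a function of `(e^σ L, β)`. -/
def p02 : LocFun n :=
  T.ev (D2 fun u v => D2 T.f u v ^ 2 + T.f u v * D2 (D2 T.f) u v)

/-- `b_i`, as a function of `(x, y)`. -/
def bLow (i : Fin n) : LocFun n := fun x _ => T.b i x

/-- `b^i = g^{ij} b_j`. -/
def bUp (i : Fin n) : LocFun n := fun x y => ∑ j, gInv T.L i j x y * T.b j x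

/-- `b² = b^i b_i`. -/
def bSq : LocFun n := fun x y => ∑ i, T.bUp i x y * T.b i x

/-- `m_i = b_i - (β / L²) y_i`. -/
def m (i : Fin n) : LocFun n := fun x y =>
  T.b i x - T.β x y / T.L x y ^ 2 * yLow T.L i x y

/-- `m² = g^{ij} m_i m_j`. -/
def mSq : LocFun n := fun x y => ∑ i, ∑ j, gInv T.L i j x y * T.m i x y * T.m j x y

/-- `σ_i = ∂ᵢ σ`. -/
def σLow (i : Fin n) : LocFun n := dx i fun x _ => T.σ x

/-- `σ^i = g^{ij} σ_j`. -/
def σUp (i : Fin n) : LocFun n := fun x y => ∑ j, gInv T.L i j x y * T.σLow j x y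

/-- `σ₀ = σ_i y^i`. -/
def σ0 : LocFun n := fun x y => ∑ i, T.σLow i x y * y i

/-- `σ_β = σ_r b^r`. -/
def σβ : LocFun n := fun x y => ∑ r, T.σLow r x y * T.bUp r x y

/-- `ε = f² (e^σ p + m² q₀) / L²`. -/
def ε : LocFun n := fun x y =>
  T.f0 x y ^ 2 * (T.eσ x y * T.p x y + T.mSq x y * T.q0 x y) / T.L x y ^ 2

/-- `s₀ = e^{-σ} f² q₀ / (ε p L²)`. -/
def s0 : LocFun n := fun x y =>
  (T.eσ x y)⁻¹ * T.f0 x y ^ 2 * T.q0 x y / (T.ε x y * T.p x y * T.L x y ^ 2)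

/-- `s₋₁ = p₋₁ f² / (p ε L²)`. -/
def sm1 : LocFun n := fun x y =>
  T.pm1 x y * T.f0 x y ^ 2 / (T.p x y * T.ε x y * T.L x y ^ 2)

/-- `s₋₂ = p₋₁ (e^σ m² p L² - b² f²) / (ε p β L²)` where `β ≠ 0`. The quotient has a removable
singularity at `β = 0`: its numerator is `-p₋₁ β (f² β / L² + q m²)`, because
`b² = m² + β² / L²` and `q β + e^σ p L² = f²`. At `β = 0` the value is the one obtained by
cancelling `β`. -/
def sm2 : LocFun n := fun x y =>
  if T.β x y = 0 then
    -(T.pm1 x y * T.q x y * T.mSq x y) / (T.ε x y * T.p x y * T.L x y ^ 2)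
  else
    T.pm1 x y * (T.eσ x y * T.mSq x y * T.p x y * T.L x y ^ 2 - T.bSq x y * T.f0 x y ^ 2) /
      (T.ε x y * T.p x y * T.β x y * T.L x y ^ 2)

/-- `V_{ijk} = ½ e^σ p₋₁ (h_{ij} m_k + h_{jk} m_i + h_{ki} m_j) + ½ p₀₂ m_i m_j m_k`. -/
def V (i j k : Fin n) : LocFun n := fun x y =>
  T.eσ x y * T.pm1 x y / 2 *
      (h T.L i j x y * T.m k x y + h T.L j k x y * T.m i x y + h T.L k i x y * T.m j x y) +
    T.p02 x y / 2 * (T.m i x y * T.m j x y * T.m k x y)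

/-- `b_{i|k}`. -/
def bCov (i k : Fin n) : LocFun n := hCov T.L T.bLow i k

/-- `b_{0|k} = b_{i|k} y^i`. -/
def b0Cov (k : Fin n) : LocFun n := fun x y => ∑ i, T.bCov i k x y * y i

/-- `E_{ij} = ½ (b_{i|j} + b_{j|i})`. -/
def E (i j : Fin n) : LocFun n := fun x y => (1 / 2) * (T.bCov i j x y + T.bCov j i x y)

/-- `F_{ij} = ½ (b_{i|j} - b_{j|i})`. -/
def F (i j : Fin n) : LocFun n := fun x y => (1 / 2) * (T.bCov i j x y - T.bCov j i x y)

/-- `E_{i0} = E_{ij} y^j`. -/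
def E0 (i : Fin n) : LocFun n := fun x y => ∑ j, T.E i j x y * y j

/-- `E_{00} = E_{ij} y^i y^j`. -/
def E00 : LocFun n := fun x y => ∑ i, T.E0 i x y * y i

/-- `F_{i0} = F_{ij} y^j`. -/
def F0 (i : Fin n) : LocFun n := fun x y => ∑ j, T.F i j x y * y j

/-- `F^i_0 = g^{ij} F_{j0}`. -/
def F0Up (i : Fin n) : LocFun n := fun x y => ∑ j, gInv T.L i j x y * T.F0 j x y

/-- `F_{β0} = F_{r0} b^r`. -/
def Fβ0 : LocFun n := fun x y => ∑ r, T.F0 r x y * T.bUp r x y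

/-- `B_{ij} = ½ (e^σ p₋₁ h_{ij} + p₀₂ m_i m_j)`. -/
def B (i j : Fin n) : LocFun n := fun x y =>
  (1 / 2) * (T.eσ x y * T.pm1 x y * h T.L i j x y + T.p02 x y * T.m i x y * T.m j x y)

/-- `Q_i = e^σ p₋₁ y_i + p₀ b_i`. -/
def Q (i : Fin n) : LocFun n := fun x y =>
  T.eσ x y * T.pm1 x y * yLow T.L i x y + T.p0 x y * T.b i x

/-- `A₁ = e^σ (2 p - β p₋₁)`. -/
def A1 : LocFun n := fun x y => T.eσ x y * (2 * T.p x y - T.β x y * T.pm1 x y)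

/-- `A₂ = -β p₀₂`. -/
def A2 : LocFun n := fun x y => -(T.β x y * T.p02 x y)

/-- `A₃ = e^σ p₋₁ + (β² / L²) p₀₂`. -/
def A3 : LocFun n := fun x y =>
  T.eσ x y * T.pm1 x y + T.β x y ^ 2 / T.L x y ^ 2 * T.p02 x y

/-- `A₄ = e^σ p₋₂ - (β³ / L⁴) p₀₂`. -/
def A4 : LocFun n := fun x y =>
  T.eσ x y * T.pm2 x y - T.β x y ^ 3 / T.L x y ^ 4 * T.p02 x y

/-- `K_{ij} = A₁ g_{ij} + A₂ b_i b_j + A₃ (b_i y_j + b_j y_i) + A₄ y_i y_j`. -/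
def K (i j : Fin n) : LocFun n := fun x y =>
  T.A1 x y * g T.L i j x y + T.A2 x y * T.b i x * T.b j x +
    T.A3 x y * (T.b i x * yLow T.L j x y + T.b j x * yLow T.L i x y) +
    T.A4 x y * yLow T.L i x y * yLow T.L j x y

/-- The vector `D^i`. -/
def Dspray (i : Fin n) : LocFun n := fun x y =>
  T.σ0 x y / (2 * T.p x y) *
      ((2 * T.p x y - T.β x y * T.pm1 x y
          - T.eσ x y * T.p x y ^ 2 * T.L x y ^ 2 * T.sm2 x y
          - T.p x y * T.sm1 x y *
            (2 * T.eσ x y * T.p x y * T.β x y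
              + T.eσ x y * T.pm1 x y * T.L x y ^ 2 * T.mSq x y)) * y i
        - 2 * T.eσ x y * T.p x y ^ 2 * T.β x y * T.s0 x y * T.bUp i x y)
    + T.q x y / T.p x y * (T.eσ x y)⁻¹ * T.F0Up i x y
    - (1 / 2) * T.L x y ^ 2 * T.σUp i x y
    + (1 / 2) * (T.eσ x y * T.p x y * T.E00 x y - 2 * T.q x y * T.Fβ0 x y
        + T.eσ x y * T.p x y * T.L x y ^ 2 * T.σβ x y) *
      (T.s0 x y * T.bUp i x y + T.sm1 x y * y i)

/-- The tensor `A_{ij}`. -/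
def A (i j : Fin n) : LocFun n := fun x y =>
  T.E00 x y * T.B i j x y + T.F0 i x y * T.Q j x y + T.q x y * T.F i j x y
    + T.E0 j x y * T.Q i x y
    - 2 * ∑ s, (T.eσ x y * T.p x y * C T.L s i j x y + T.V s i j x y) * T.Dspray s x y
    + (1 / 2) * T.σ0 x y *
      (2 * T.eσ x y * T.p x y * g T.L i j x y
        + 2 * T.eσ x y * T.pm1 x y * T.m j x y * yLow T.L i x y
        - 2 * T.β x y * T.B i j x y
        + T.eσ x y * T.pm1 x y * (T.b i x * yLow T.L j x y - T.b j x * yLow T.L i x y))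
    - (1 / 2) * T.σLow i x y *
      (T.eσ x y * T.L x y ^ 2 * T.pm1 x y * T.m j x y
        + 2 * T.eσ x y * T.p x y * yLow T.L j x y)
    + (1 / 2) * T.σLow j x y *
      (2 * T.eσ x y * T.p x y * yLow T.L i x y
        + T.eσ x y * T.L x y ^ 2 * T.pm1 x y * T.m i x y)

/-- `A^i_j = g^{li} A_{lj}`. -/
def AUp (i j : Fin n) : LocFun n := fun x y => ∑ l, gInv T.L l i x y * T.A l j x y

/-- The tensor `D^i_j`. -/
def Dnonlin (i j : Fin n) : LocFun n := fun x y =>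
  (T.eσ x y)⁻¹ / T.p x y * T.AUp i j x y
    - (T.s0 x y * T.bUp i x y + T.sm1 x y * y i) * ∑ r, T.A r j x y * T.bUp r x y
    - (T.q x y * T.b0Cov j x y + T.eσ x y * T.p x y * T.L x y ^ 2 * T.σLow j x y) *
      (T.sm1 x y * T.bUp i x y + T.sm2 x y * y i)

/-- `(e^{-σ} / p) g^{ir} - (s₀ b^i + s₋₁ y^i) b^r - (s₋₁ b^i + s₋₂ y^i) y^r`. -/
def newInv (i r : Fin n) : LocFun n := fun x y =>
  (T.eσ x y)⁻¹ / T.p x y * gInv T.L i r x y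
    - (T.s0 x y * T.bUp i x y + T.sm1 x y * y i) * T.bUp r x y
    - (T.sm1 x y * T.bUp i x y + T.sm2 x y * y i) * y r

/-- `Θ_{(j,k,r)}{X_{jkr}} = X_{jkr} - X_{krj} - X_{rjk}`. -/
def Theta (X : Fin n → Fin n → Fin n → LocFun n) (j k r : Fin n) : LocFun n :=
  fun x y => X j k r x y - X k r j x y - X r j k x y

/-- `2 e^σ p C_{jkm} D^m_r + 2 V_{jkm} D^m_r - K_{jk} σ_r - 2 B_{jk} b_{0|r}`. -/
def thetaArg (j k r : Fin n) : LocFun n := fun x y =>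
  2 * T.eσ x y * T.p x y * ∑ m, C T.L j k m x y * T.Dnonlin m r x y
    + 2 * ∑ m, T.V j k m x y * T.Dnonlin m r x y
    - T.K j k x y * T.σLow r x y
    - 2 * T.B j k x y * T.b0Cov r x y

/-- The difference tensor `D^i_{jk}`. -/
def Dten (i j k : Fin n) : LocFun n := fun x y =>
  ∑ r, T.newInv i r x y *
    (T.F r k x y * T.Q j x y + T.F r j x y * T.Q k x y + T.E j k x y * T.Q r x y
      + (1 / 2) * Theta T.thetaArg j k r x y)

end LocalChange

/-! ## Finsler structures on a manifold -/

section Manifold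

variable {n : ℕ} {M : Type*} [TopologicalSpace M] [ChartedSpace (Coord n) M]

/-- The tangent vector `y^i ∂ᵢ` at the point with coordinates `x`, in the chart `φ`. -/
def tangentVec (φ : OpenPartialHomeomorph M (Coord n)) (x y : Coord n) :
    TangentBundle (𝓡 n) M :=
  ⟨φ.symm x, mfderiv (𝓡 n) (𝓡 n) φ.symm x y⟩

/-- The expression in the chart `φ` of a function on the tangent bundle. -/
def locFun (φ : OpenPartialHomeomorph M (Coord n)) (L : TangentBundle (𝓡 n) M → ℝ) :
    LocFun n :=
  fun x y => L (tangentVec φ x y)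

/-- The expression in the chart `φ` of a set of tangent vectors. -/
def locDom (φ : OpenPartialHomeomorph M (Coord n)) (A : Set (TangentBundle (𝓡 n) M)) :
    Set (Coord n × Coord n) :=
  {z | z.1 ∈ φ.target ∧ tangentVec φ z.1 z.2 ∈ A}

/-- The component `b_i` in the chart `φ` of a differential one-form on `M`. -/
def locForm (φ : OpenPartialHomeomorph M (Coord n))
    (β : (x : M) → TangentSpace (𝓡 n) x →L[ℝ] ℝ) (i : Fin n) : Coord n → ℝ :=
  fun x => β (tangentVec φ x (basisVec i)).proj (tangentVec φ x (basisVec i)).snd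

/-- The multiple `c v` of a tangent vector `v`, in the fibre of `v`. -/
def scale (c : ℝ) (v : TangentBundle (𝓡 n) M) : TangentBundle (𝓡 n) M :=
  ⟨v.proj, c • v.snd⟩

/-- `A` is an open set of nonzero tangent vectors which is stable under multiplication by positive
numbers. (Openness in the tangent bundle is expressed in the charts.) -/
structure IsConicDomain (A : Set (TangentBundle (𝓡 n) M)) : Prop where
  isOpen : ∀ φ ∈ IsManifold.maximalAtlas (𝓡 n) ∞ M, IsOpen (locDom φ A)
  ne_zero : ∀ v ∈ A, v.snd ≠ 0
  scale_mem : ∀ v ∈ A, ∀ c : ℝ, 0 < c → scale c v ∈ A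

/-- `L` is a (smooth) Finsler structure with domain `A`: it is positive, positively homogeneous of
degree one and smooth on `A`, and its metric tensor `g_{ij} = ½ ∂̇ᵢ ∂̇ⱼ L²` is nondegenerate
on `A`. -/
structure IsFinsler (A : Set (TangentBundle (𝓡 n) M)) (L : TangentBundle (𝓡 n) M → ℝ) :
    Prop where
  pos : ∀ v ∈ A, 0 < L v
  homog : ∀ v ∈ A, ∀ c : ℝ, 0 < c → L (scale c v) = c * L v
  smooth : ∀ φ ∈ IsManifold.maximalAtlas (𝓡 n) ∞ M,
    ContDiffOn ℝ ∞ (fun z : Coord n × Coord n => locFun φ L z.1 z.2) (locDom φ A)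
  nondeg : ∀ φ ∈ IsManifold.maximalAtlas (𝓡 n) ∞ M, ∀ x y : Coord n, (x, y) ∈ locDom φ A →
    (gMat (locFun φ L) x y).det ≠ 0

/-- A smooth differential one-form on `M`: its components in every chart are smooth. -/
def IsSmoothForm (β : (x : M) → TangentSpace (𝓡 n) x →L[ℝ] ℝ) : Prop :=
  ∀ φ ∈ IsManifold.maximalAtlas (𝓡 n) ∞ M, ∀ i : Fin n,
    ContDiffOn ℝ ∞ (locForm φ β i) φ.target

/-- `f` is smooth and positively homogeneous of degree one on the open cone `Ω ⊆ ℝ²`. -/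
structure IsHomogOn (f : ℝ → ℝ → ℝ) (Ω : Set (ℝ × ℝ)) : Prop where
  isOpen : IsOpen Ω
  smul_mem : ∀ u v : ℝ, (u, v) ∈ Ω → ∀ c : ℝ, 0 < c → (c * u, c * v) ∈ Ω
  smooth : ContDiffOn ℝ ∞ (fun w : ℝ × ℝ => f w.1 w.2) Ω
  homog : ∀ u v : ℝ, (u, v) ∈ Ω → ∀ c : ℝ, 0 < c → f (c * u) (c * v) = c * f u v

/-- `L̄ = f(e^σ L, β)`, on the tangent bundle. -/
def changed (L : TangentBundle (𝓡 n) M → ℝ) (σ : M → ℝ)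
    (β : (x : M) → TangentSpace (𝓡 n) x →L[ℝ] ℝ) (f : ℝ → ℝ → ℝ) :
    TangentBundle (𝓡 n) M → ℝ :=
  fun v => f (Real.exp (σ v.proj) * L v) (β v.proj v.snd)

/-- The expression in the chart `φ` of the data of a generalized `β`-conformal change. -/
def localChange (φ : OpenPartialHomeomorph M (Coord n)) (L : TangentBundle (𝓡 n) M → ℝ)
    (σ : M → ℝ) (β : (x : M) → TangentSpace (𝓡 n) x →L[ℝ] ℝ) (f : ℝ → ℝ → ℝ) :
    LocalChange n where
  L := locFun φ L
  σ := fun x => σ (φ.symm x)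
  b := locForm φ β
  f := f

end Manifold

end GenBetaConformal

end

open scoped Manifold ContDiff

noncomputable section

namespace GenBetaConformal

/-! Everything is local: in a chart the data become functions on an open set `U` of pairs `(x, y)`,
and positive homogeneity becomes Euler's relation. Write a bar for objects of the new structure.

The metric. Homogeneity of `f` ties together the coefficients of the new metric (`cG_mul`,
`cBY_mul`, `cYY_mul`). Hence one rule, `hasPd_ev`, differentiates all of them along any direction in
which the derivatives of `L`, `σ` and `β` are known. Vertical directions give the new metric and the
new Cartan tensor (`g_f0`, `C_f0`). Horizontal directions of the old connection give the old
covariant derivative of the new metric (`delta_g_f0`), because `L` and `y_i` are horizontally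
constant and `δ_k β = b_{0|k}`. The new metric is `cG` times the old one plus a term built from `b`
and `y`, so its inverse can be checked by hand once `ε ≠ 0`; this in turn follows from the
nondegeneracy of both metrics (`ε_ne`).

The connection. The Christoffel formula for `Γ̄ - Γ` with its upper index lowered by `ḡ`
(`sum_g_f0_Gam_sub`) contains the unknown `N̄ - N`, but only contracted with the new Cartan tensor
`C̄`. One contraction with `y` replaces it by the spray difference `Ḡ - G` (`sum_g_f0_N_sub`), and a
second one removes it, since `C̄` annihilates `y` (`sum_g_f0_G_sub`). The system is therefore
triangular: applying `ḡ⁻¹` gives `Ḡ - G = D^i` (`G_f0_sub`), then `N̄ - N = D^i_j` (`N_f0_sub`), and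
finally `Γ̄ - Γ = D^i_{jk}` (`Gam_f0`). Two classical facts about any Cartan connection make the
contractions work: `Γ^i_{jk} y^j = N^i_k` and `N^i_k y^k = 2 G^i`. -/

/-! ## Directional derivatives of functions of two vector variables -/

section Calculus

variable {E₁ E₂ : Type*} [NormedAddCommGroup E₁] [NormedSpace ℝ E₁]
  [NormedAddCommGroup E₂] [NormedSpace ℝ E₂]

/-- The derivative of `F(x, y)` in the direction `v`. -/
def pd (v : E₁ × E₂) (F : E₁ → E₂ → ℝ) : E₁ → E₂ → ℝ :=
  fun x y => fderiv ℝ (fun z : E₁ × E₂ => F z.1 z.2) (x, y) v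

/-- `F(x, y)` is differentiable at `(x, y)` with derivative `d` in the direction `v`. -/
def HasPd (v : E₁ × E₂) (F : E₁ → E₂ → ℝ) (x : E₁) (y : E₂) (d : ℝ) : Prop :=
  DifferentiableAt ℝ (fun z : E₁ × E₂ => F z.1 z.2) (x, y) ∧ pd v F x y = d

/-- `F(x, y)` is smooth on `U`. -/
def SmoothOn (U : Set (E₁ × E₂)) (F : E₁ → E₂ → ℝ) : Prop :=
  ContDiffOn ℝ ∞ (fun z : E₁ × E₂ => F z.1 z.2) U

/-- `F` and `F'` agree on `U`. -/
def AgreeOn (U : Set (E₁ × E₂)) (F F' : E₁ → E₂ → ℝ) : Prop :=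
  ∀ x y, (x, y) ∈ U → F x y = F' x y

variable {U : Set (E₁ × E₂)} {F K : E₁ → E₂ → ℝ} {v w : E₁ × E₂} {x : E₁} {y : E₂} {d e : ℝ}

/-- Together with `HasPd.congr` this is how identities are differentiated: both sides agree on an
open set, each is differentiated by the product rule, and the two values are compared. -/
theorem HasPd.unique (h₁ : HasPd v F x y d) (h₂ : HasPd v F x y e) : d = e :=
  h₁.2.symm.trans h₂.2

theorem HasPd.of_eq (h₁ : HasPd v F x y d) (hde : d = e) : HasPd v F x y e := hde ▸ h₁

theorem HasPd.congr (hU : IsOpen U) (hz : (x, y) ∈ U) (hFK : AgreeOn U F K)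
    (h₁ : HasPd v F x y d) : HasPd v K x y d := by
  have h2 : (fun z : E₁ × E₂ => K z.1 z.2) =ᶠ[nhds (x, y)] fun z => F z.1 z.2 := by
    filter_upwards [hU.mem_nhds hz] with z hz
    exact (hFK z.1 z.2 hz).symm
  refine ⟨h₁.1.congr_of_eventuallyEq h2, ?_⟩
  rw [← h₁.2, pd, pd, h2.fderiv_eq]

theorem hasPd_const (c : ℝ) : HasPd v (fun _ _ => c) x y 0 :=
  ⟨differentiableAt_const c, by simp [pd]⟩

theorem HasPd.add (h₁ : HasPd v F x y d) (h₂ : HasPd v K x y e) :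
    HasPd v (fun x y => F x y + K x y) x y (d + e) := by
  refine ⟨h₁.1.add h₂.1, ?_⟩
  have := fderiv_add h₁.1 h₂.1
  rw [← h₁.2, ← h₂.2, pd, pd, pd]
  exact congrArg (fun l => l v) this

theorem HasPd.mul (h₁ : HasPd v F x y d) (h₂ : HasPd v K x y e) :
    HasPd v (fun x y => F x y * K x y) x y (d * K x y + F x y * e) := by
  refine ⟨h₁.1.mul h₂.1, ?_⟩
  have := fderiv_mul h₁.1 h₂.1
  rw [← h₁.2, ← h₂.2, pd, pd, pd]
  refine (congrArg (fun l => l v) this).trans ?_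
  simp
  ring

theorem HasPd.const_mul (c : ℝ) (h₁ : HasPd v F x y d) :
    HasPd v (fun x y => c * F x y) x y (c * d) :=
  ((hasPd_const c).mul h₁).of_eq (by ring)

theorem HasPd.sub (h₁ : HasPd v F x y d) (h₂ : HasPd v K x y e) :
    HasPd v (fun x y => F x y - K x y) x y (d - e) := by
  have := h₁.add (h₂.const_mul (-1))
  simpa [sub_eq_add_neg] using this

theorem HasPd.sq (h₁ : HasPd v F x y d) :
    HasPd v (fun x y => F x y ^ 2) x y (2 * F x y * d) := by
  have := (h₁.mul h₁).of_eq (show d * F x y + F x y * d = 2 * F x y * d by ring)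
  simpa only [pow_two] using this

theorem HasPd.sum {ι : Type*} (s : Finset ι) {F : ι → E₁ → E₂ → ℝ} {d : ι → ℝ}
    (h₁ : ∀ i ∈ s, HasPd v (F i) x y (d i)) :
    HasPd v (fun x y => ∑ i ∈ s, F i x y) x y (∑ i ∈ s, d i) := by
  classical
  induction s using Finset.induction_on with
  | empty => simpa using hasPd_const (v := v) (x := x) (y := y) 0
  | insert i s hi ih =>
    simp only [Finset.sum_insert hi]
    exact (h₁ i (Finset.mem_insert_self i s)).add
      (ih fun j hj => h₁ j (Finset.mem_insert_of_mem hj))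

theorem HasPd.comp {H : ℝ → ℝ → ℝ} (h₁ : HasPd v F x y d) (h₂ : HasPd v K x y e)
    (hH : DifferentiableAt ℝ (fun w : ℝ × ℝ => H w.1 w.2) (F x y, K x y)) :
    HasPd v (fun x y => H (F x y) (K x y)) x y
      (pd (1, 0) H (F x y) (K x y) * d + pd (0, 1) H (F x y) (K x y) * e) := by
  have h3 := h₁.1.hasFDerivAt.prodMk h₂.1.hasFDerivAt
  have h4 := HasFDerivAt.comp (x, y) (f := fun z : E₁ × E₂ => (F z.1 z.2, K z.1 z.2))
    hH.hasFDerivAt h3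
  refine ⟨h4.differentiableAt, ?_⟩
  refine (congrArg (fun l => l v) h4.fderiv).trans ?_
  simp only [ContinuousLinearMap.comp_apply, ContinuousLinearMap.prod_apply]
  change fderiv ℝ (fun w : ℝ × ℝ => H w.1 w.2) (F x y, K x y) (pd v F x y, pd v K x y) = _
  rw [h₁.2, h₂.2]
  have : ((d, e) : ℝ × ℝ) = d • (1, 0) + e • (0, 1) := by simp
  rw [this, map_add, map_smul, map_smul, pd, pd, smul_eq_mul, smul_eq_mul]
  ring

theorem HasPd.comp₁ {φ : ℝ → ℝ} {φ' : ℝ} (h₁ : HasPd v F x y d) (hφ : HasDerivAt φ φ' (F x y)) :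
    HasPd v (fun x y => φ (F x y)) x y (φ' * d) := by
  have h4 := HasDerivAt.comp_hasFDerivAt (x, y) (f := fun z : E₁ × E₂ => F z.1 z.2) hφ
    h₁.1.hasFDerivAt
  refine ⟨h4.differentiableAt, ?_⟩
  refine (congrArg (fun l => l v) h4.fderiv).trans ?_
  rw [← h₁.2]
  rfl

theorem HasPd.div (h₁ : HasPd v F x y d) (h₂ : HasPd v K x y e) (hK : K x y ≠ 0) :
    HasPd v (fun x y => F x y / K x y) x y (d / K x y - F x y * e / K x y ^ 2) := by
  have := h₁.mul (h₂.comp₁ (hasDerivAt_inv hK))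
  simp only [← div_eq_mul_inv] at this
  exact this.of_eq (by field_simp; ring)

/-- Linearity in the direction is what lets `δ_k`, a combination of coordinate derivatives with
coefficients depending on the point, be treated at each point as a single directional derivative. -/
theorem HasPd.linear (h₁ : DifferentiableAt ℝ (fun z : E₁ × E₂ => F z.1 z.2) (x, y))
    {ι : Type*} (s : Finset ι) (c : ι → ℝ) (w : ι → E₁ × E₂) :
    HasPd (v + ∑ i ∈ s, c i • w i) F x y (pd v F x y + ∑ i ∈ s, c i * pd (w i) F x y) :=
  ⟨h₁, by simp [pd, map_add, map_sum]⟩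

theorem SmoothOn.differentiableAt (hF : SmoothOn U F) (hU : IsOpen U) (hz : (x, y) ∈ U) :
    DifferentiableAt ℝ (fun z : E₁ × E₂ => F z.1 z.2) (x, y) :=
  (hF.contDiffAt (hU.mem_nhds hz)).differentiableAt (by simp)

theorem SmoothOn.hasPd (hF : SmoothOn U F) (hU : IsOpen U) (hz : (x, y) ∈ U) :
    HasPd v F x y (pd v F x y) :=
  ⟨hF.differentiableAt hU hz, rfl⟩

theorem SmoothOn.congr (hF : SmoothOn U F) (hFK : AgreeOn U F K) : SmoothOn U K :=
  ContDiffOn.congr hF fun z hz => (hFK z.1 z.2 hz).symm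

theorem smoothOn_const (c : ℝ) : SmoothOn U fun _ _ => c := contDiffOn_const

theorem SmoothOn.add (hF : SmoothOn U F) (hK : SmoothOn U K) :
    SmoothOn U fun x y => F x y + K x y := ContDiffOn.add hF hK

theorem SmoothOn.sub (hF : SmoothOn U F) (hK : SmoothOn U K) :
    SmoothOn U fun x y => F x y - K x y := ContDiffOn.sub hF hK

theorem SmoothOn.mul (hF : SmoothOn U F) (hK : SmoothOn U K) :
    SmoothOn U fun x y => F x y * K x y := ContDiffOn.mul hF hK

theorem SmoothOn.const_mul (c : ℝ) (hF : SmoothOn U F) : SmoothOn U fun x y => c * F x y :=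
  (smoothOn_const c).mul hF

theorem SmoothOn.sq (hF : SmoothOn U F) : SmoothOn U fun x y => F x y ^ 2 := ContDiffOn.pow hF 2

theorem SmoothOn.sum {ι : Type*} (s : Finset ι) {F : ι → E₁ → E₂ → ℝ}
    (hF : ∀ i ∈ s, SmoothOn U (F i)) : SmoothOn U fun x y => ∑ i ∈ s, F i x y :=
  ContDiffOn.sum hF

theorem SmoothOn.inv (hF : SmoothOn U F) (h0 : ∀ x y, (x, y) ∈ U → F x y ≠ 0) :
    SmoothOn U fun x y => (F x y)⁻¹ := ContDiffOn.inv hF fun z hz => h0 z.1 z.2 hz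

theorem SmoothOn.pd (hF : SmoothOn U F) (hU : IsOpen U) (v : E₁ × E₂) : SmoothOn U (pd v F) :=
  ContDiffOn.clm_apply (ContDiffOn.fderiv_of_isOpen hF hU (by simp)) contDiffOn_const

theorem SmoothOn.pd_comm (hF : SmoothOn U F) (hU : IsOpen U) (hz : (x, y) ∈ U)
    (v w : E₁ × E₂) :
    GenBetaConformal.pd v (GenBetaConformal.pd w F) x y =
      GenBetaConformal.pd w (GenBetaConformal.pd v F) x y := by
  have h1 : ContDiffAt ℝ ∞ (fun z : E₁ × E₂ => F z.1 z.2) (x, y) :=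
    hF.contDiffAt (hU.mem_nhds hz)
  have h2 := h1.isSymmSndFDerivAt (by simpa using WithTop.coe_le_coe.2 (le_top (a := (2 : ℕ∞))))
  have h3 : DifferentiableAt ℝ (fderiv ℝ fun z : E₁ × E₂ => F z.1 z.2) (x, y) :=
    (h1.fderiv_right (m := ∞) (by simp)).differentiableAt (by simp)
  have key : ∀ v w : E₁ × E₂, GenBetaConformal.pd v (GenBetaConformal.pd w F) x y =
      fderiv ℝ (fderiv ℝ fun z : E₁ × E₂ => F z.1 z.2) (x, y) v w := by
    intro v w
    have := (h3.hasFDerivAt.clm_apply (hasFDerivAt_const w (x, y))).fderiv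
    refine (congrArg (fun l => l v) this).trans ?_
    simp
  rw [key, key, h2.eq]

end Calculus

/-! ### Coordinate derivatives and `δ_k` as directional derivatives. -/

section Partial

variable {n : ℕ} {U : Set (Coord n × Coord n)} {F K : LocFun n} {x y : Coord n}

/-- `dx` and `dy` differentiate slices; joint differentiability identifies them with `pd`, so that
the rules for `HasPd` apply. -/
theorem dx_eq_pd (hF : DifferentiableAt ℝ (fun z : Coord n × Coord n => F z.1 z.2) (x, y))
    (i : Fin n) : dx i F x y = pd (basisVec i, 0) F x y := by
  have h1 : HasFDerivAt (fun x' : Coord n => (x', y)) (.inl ℝ (Coord n) (Coord n)) x :=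
    (hasFDerivAt_id x).prodMk (hasFDerivAt_const y x)
  have h2 := HasFDerivAt.comp x (f := fun x' : Coord n => (x', y)) hF.hasFDerivAt h1
  refine (congrArg (fun l => l (basisVec i)) h2.fderiv).trans ?_
  simp [pd]

theorem dy_eq_pd (hF : DifferentiableAt ℝ (fun z : Coord n × Coord n => F z.1 z.2) (x, y))
    (i : Fin n) : dy i F x y = pd (0, basisVec i) F x y := by
  have h1 : HasFDerivAt (fun y' : Coord n => (x, y')) (.inr ℝ (Coord n) (Coord n)) y :=
    (hasFDerivAt_const x y).prodMk (hasFDerivAt_id y)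
  have h2 := HasFDerivAt.comp y (f := fun y' : Coord n => (x, y')) hF.hasFDerivAt h1
  refine (congrArg (fun l => l (basisVec i)) h2.fderiv).trans ?_
  simp [pd]

theorem HasPd.dx_eq {i : Fin n} {d : ℝ} (h₁ : HasPd (basisVec i, 0) F x y d) : dx i F x y = d :=
  (dx_eq_pd h₁.1 i).trans h₁.2

theorem HasPd.dy_eq {i : Fin n} {d : ℝ} (h₁ : HasPd (0, basisVec i) F x y d) : dy i F x y = d :=
  (dy_eq_pd h₁.1 i).trans h₁.2

theorem SmoothOn.hasPd_dx (hF : SmoothOn U F) (hU : IsOpen U) (hz : (x, y) ∈ U) (i : Fin n) :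
    HasPd (basisVec i, 0) F x y (dx i F x y) :=
  (hF.hasPd hU hz).of_eq (dx_eq_pd (hF.differentiableAt hU hz) i).symm

theorem SmoothOn.hasPd_dy (hF : SmoothOn U F) (hU : IsOpen U) (hz : (x, y) ∈ U) (i : Fin n) :
    HasPd (0, basisVec i) F x y (dy i F x y) :=
  (hF.hasPd hU hz).of_eq (dy_eq_pd (hF.differentiableAt hU hz) i).symm

theorem SmoothOn.agreeOn_dx (hF : SmoothOn U F) (hU : IsOpen U) (i : Fin n) :
    AgreeOn U (GenBetaConformal.pd (basisVec i, 0) F) (dx i F) :=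
  fun _ _ hz => (dx_eq_pd (hF.differentiableAt hU hz) i).symm

theorem SmoothOn.agreeOn_dy (hF : SmoothOn U F) (hU : IsOpen U) (i : Fin n) :
    AgreeOn U (GenBetaConformal.pd (0, basisVec i) F) (dy i F) :=
  fun _ _ hz => (dy_eq_pd (hF.differentiableAt hU hz) i).symm

theorem SmoothOn.dx (hF : SmoothOn U F) (hU : IsOpen U) (i : Fin n) : SmoothOn U (dx i F) :=
  (hF.pd hU _).congr (hF.agreeOn_dx hU i)

theorem SmoothOn.dy (hF : SmoothOn U F) (hU : IsOpen U) (i : Fin n) : SmoothOn U (dy i F) :=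
  (hF.pd hU _).congr (hF.agreeOn_dy hU i)

theorem SmoothOn.dy_comm (hF : SmoothOn U F) (hU : IsOpen U) (hz : (x, y) ∈ U) (i j : Fin n) :
    GenBetaConformal.dy i (GenBetaConformal.dy j F) x y =
      GenBetaConformal.dy j (GenBetaConformal.dy i F) x y := by
  rw [(((hF.pd hU _).hasPd hU hz).congr hU hz (hF.agreeOn_dy hU j)).dy_eq,
    (((hF.pd hU _).hasPd hU hz).congr hU hz (hF.agreeOn_dy hU i)).dy_eq, hF.pd_comm hU hz]

theorem SmoothOn.dx_dy_comm (hF : SmoothOn U F) (hU : IsOpen U) (hz : (x, y) ∈ U)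
    (i j : Fin n) :
    GenBetaConformal.dx i (GenBetaConformal.dy j F) x y =
      GenBetaConformal.dy j (GenBetaConformal.dx i F) x y := by
  rw [(((hF.pd hU _).hasPd hU hz).congr hU hz (hF.agreeOn_dy hU j)).dx_eq,
    (((hF.pd hU _).hasPd hU hz).congr hU hz (hF.agreeOn_dx hU i)).dy_eq, hF.pd_comm hU hz]

theorem hasPd_coord (v : Coord n × Coord n) (i : Fin n) :
    HasPd v (fun _ y : Coord n => y i) x y (v.2 i) := by
  have h : HasFDerivAt (fun z : Coord n × Coord n => z.2 i)
      ((EuclideanSpace.proj i : Coord n →L[ℝ] ℝ).comp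
        (.snd ℝ (Coord n) (Coord n))) (x, y) :=
    ((EuclideanSpace.proj i : Coord n →L[ℝ] ℝ).comp
        (.snd ℝ (Coord n) (Coord n))).hasFDerivAt
  exact ⟨h.differentiableAt, (congrArg (fun l => l v) h.fderiv).trans (by simp)⟩

theorem smoothOn_coord (i : Fin n) : SmoothOn U (fun _ y : Coord n => y i) :=
  ((EuclideanSpace.proj i : Coord n →L[ℝ] ℝ).comp
        (.snd ℝ (Coord n) (Coord n))).contDiff.contDiffOn

theorem basisVec_apply (i j : Fin n) : (basisVec i : Coord n) j = if j = i then 1 else 0 := by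
  simp [basisVec]

/-- The direction of the derivation `δ_k` at `(x, y)`. -/
def deltaVec (L : LocFun n) (k : Fin n) (x y : Coord n) : Coord n × Coord n :=
  (basisVec k, 0) + ∑ r, (-N L r k x y) • ((0 : Coord n), basisVec r)

theorem deltaVec_snd (L : LocFun n) (k j : Fin n) :
    (deltaVec L k x y).2 j = -N L j k x y := by
  simp [deltaVec, Prod.snd_sum, basisVec_apply]

theorem SmoothOn.hasPd_delta (hF : SmoothOn U F) (hU : IsOpen U) (hz : (x, y) ∈ U)
    (L : LocFun n) (k : Fin n) : HasPd (deltaVec L k x y) F x y (delta L k F x y) := by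
  have hd := hF.differentiableAt hU hz
  refine (HasPd.linear hd _ _ _).of_eq ?_
  simp only [delta, dx_eq_pd hd, dy_eq_pd hd, neg_mul, Finset.sum_neg_distrib]
  ring

theorem HasPd.delta_eq {L : LocFun n} {k : Fin n} {d : ℝ}
    (h₁ : HasPd (deltaVec L k x y) F x y d) : delta L k F x y = d := by
  have hd := h₁.1
  refine Eq.trans ?_ ((HasPd.linear hd _ _ _).unique h₁)
  simp only [delta, dx_eq_pd hd, dy_eq_pd hd, neg_mul, Finset.sum_neg_distrib]
  ring

end Partial

/-! ## Finsler structures in local coordinates -/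

section Euler

variable {n : ℕ} {U : Set (Coord n × Coord n)} {F K : LocFun n} {x y : Coord n}

/-- Euler's relation of degree `k` for `F` on `U`. -/
def EulerOn (U : Set (Coord n × Coord n)) (k : ℝ) (F : LocFun n) : Prop :=
  ∀ x y, (x, y) ∈ U → ∑ i, y i * dy i F x y = k * F x y

/-- Differentiating Euler's relation in `y^j` produces one extra term `∂̇_j F`, which lowers the
degree by one. -/
theorem EulerOn.dy {k : ℝ} (hE : EulerOn U k F) (hF : SmoothOn U F) (hU : IsOpen U) (j : Fin n) :
    EulerOn U (k - 1) (dy j F) := by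
  intro x y hz
  have h1 : HasPd (0, basisVec j) (fun x y => ∑ i, y i * GenBetaConformal.dy i F x y) x y _ :=
    HasPd.sum Finset.univ fun i _ =>
      (hasPd_coord (0, basisVec j) i).mul ((hF.dy hU i).hasPd_dy hU hz j)
  have h2 := (h1.congr hU hz hE).unique ((hF.hasPd_dy hU hz j).const_mul k)
  simp only [basisVec_apply, Finset.sum_add_distrib, ite_mul, one_mul, zero_mul,
    Finset.sum_ite_eq', Finset.mem_univ, if_true, hF.dy_comm hU hz j] at h2
  linear_combination h2

theorem EulerOn.sq (hE : EulerOn U 1 F) (hF : SmoothOn U F) (hU : IsOpen U) :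
    EulerOn U 2 fun x y => F x y ^ 2 := by
  intro x y hz
  have h1 : ∀ i, GenBetaConformal.dy i (fun x y => F x y ^ 2) x y =
      2 * F x y * GenBetaConformal.dy i F x y := fun i => ((hF.hasPd_dy hU hz i).sq).dy_eq
  have h2 := hE x y hz
  calc ∑ i, y i * GenBetaConformal.dy i (fun x y => F x y ^ 2) x y
      = 2 * F x y * ∑ i, y i * GenBetaConformal.dy i F x y := by
        rw [Finset.mul_sum]
        exact Finset.sum_congr rfl fun i _ => by rw [h1]; ring
    _ = _ := by rw [h2]; ring

theorem EulerOn.const_mul {k : ℝ} (hE : EulerOn U k F) (hF : SmoothOn U F) (hU : IsOpen U)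
    (c : ℝ) : EulerOn U k fun x y => c * F x y := by
  intro x y hz
  have h1 : ∀ i, GenBetaConformal.dy i (fun x y => c * F x y) x y =
      c * GenBetaConformal.dy i F x y := fun i => ((hF.hasPd_dy hU hz i).const_mul c).dy_eq
  calc ∑ i, y i * GenBetaConformal.dy i (fun x y => c * F x y) x y
      = c * ∑ i, y i * GenBetaConformal.dy i F x y := by
        rw [Finset.mul_sum]
        exact Finset.sum_congr rfl fun i _ => by rw [h1]; ring
    _ = _ := by rw [hE x y hz]; ring

theorem smoothOn_det {m : ℕ} {Z : Fin m → Fin m → LocFun n}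
    (hZ : ∀ i j, SmoothOn U (Z i j)) :
    SmoothOn U fun x y => (Matrix.of fun i j => Z i j x y).det := by
  simp only [Matrix.det_apply']
  exact SmoothOn.sum _ fun τ _ => SmoothOn.const_mul _
    (contDiffOn_prod fun i _ => hZ (τ i) i)

end Euler

/-- `L` is a fundamental function in local coordinates on the set `U`. -/
structure LocalFinsler {n : ℕ} (U : Set (Coord n × Coord n)) (L : LocFun n) : Prop where
  isOpen : IsOpen U
  smooth : SmoothOn U L
  pos : ∀ x y, (x, y) ∈ U → 0 < L x y
  euler : EulerOn U 1 L
  det_ne : ∀ x y, (x, y) ∈ U → (gMat L x y).det ≠ 0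

/-! ### Metric, spray, Barthel and Cartan connections of a single Finsler structure. -/

namespace LocalFinsler

variable {n : ℕ} {U : Set (Coord n × Coord n)} {L : LocFun n} {x y : Coord n}

theorem smooth_sq (hL : LocalFinsler U L) : SmoothOn U fun x y => L x y ^ 2 := hL.smooth.sq

theorem smooth_dy_sq (hL : LocalFinsler U L) (i : Fin n) :
    SmoothOn U (dy i fun x y => L x y ^ 2) := hL.smooth_sq.dy hL.isOpen i

theorem smooth_g (hL : LocalFinsler U L) (i j : Fin n) : SmoothOn U (g L i j) :=
  ((hL.smooth_dy_sq j).dy hL.isOpen i).const_mul _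

theorem g_symm (hL : LocalFinsler U L) (hz : (x, y) ∈ U) (i j : Fin n) :
    g L i j x y = g L j i x y := by
  rw [g, g, hL.smooth_sq.dy_comm hL.isOpen hz]

theorem gInv_symm (hL : LocalFinsler U L) (hz : (x, y) ∈ U) (i j : Fin n) :
    gInv L i j x y = gInv L j i x y := by
  have h1 : (gMat L x y).transpose = gMat L x y := by
    ext i j
    exact hL.g_symm hz j i
  have h2 := Matrix.transpose_nonsing_inv (gMat L x y)
  rw [h1] at h2
  exact (congrFun (congrFun h2 j) i)

theorem sum_g_gInv (hL : LocalFinsler U L) (hz : (x, y) ∈ U) (i : Fin n) (X : Fin n → ℝ) :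
    ∑ r, g L i r x y * ∑ s, gInv L r s x y * X s = X i := by
  have h := Matrix.mul_nonsing_inv (gMat L x y) (isUnit_iff_ne_zero.2 (hL.det_ne x y hz))
  have h2 := congrFun (congrArg (fun Z => Matrix.mulVec Z X) h) i
  simp only [← Matrix.mulVec_mulVec, Matrix.one_mulVec] at h2
  exact h2

theorem sum_gInv_g (hL : LocalFinsler U L) (hz : (x, y) ∈ U) (i : Fin n) (X : Fin n → ℝ) :
    ∑ r, gInv L i r x y * ∑ s, g L r s x y * X s = X i := by
  have h := Matrix.nonsing_inv_mul (gMat L x y) (isUnit_iff_ne_zero.2 (hL.det_ne x y hz))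
  have h2 := congrFun (congrArg (fun Z => Matrix.mulVec Z X) h) i
  simp only [← Matrix.mulVec_mulVec, Matrix.one_mulVec] at h2
  exact h2

/-- By nondegeneracy it is enough to compare tensors with an index lowered, where the formulas are
free of `g^{ij}`. -/
theorem eq_of_lower (hL : LocalFinsler U L) (hz : (x, y) ∈ U) {X Y : Fin n → ℝ}
    (h : ∀ r, ∑ s, g L r s x y * X s = ∑ s, g L r s x y * Y s) (i : Fin n) : X i = Y i := by
  rw [← hL.sum_gInv_g hz i X, ← hL.sum_gInv_g hz i Y]
  simp only [h]

theorem smooth_gInv (hL : LocalFinsler U L) (i j : Fin n) : SmoothOn U (gInv L i j) := by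
  have h1 : SmoothOn U fun x y => (Matrix.of fun i j => g L i j x y).det :=
    smoothOn_det hL.smooth_g
  -- Cramer's rule: an adjugate entry is the determinant of the matrix with one row replaced by a
  -- constant unit vector, hence smooth like every determinant of smooth entries.
  have h2 : SmoothOn U fun x y => (gMat L x y).adjugate i j := by
    have h3 : ∀ k l, SmoothOn U
        ((fun k l x y => (gMat L x y).updateRow j (Pi.single i 1) k l :
          Fin n → Fin n → LocFun n) k l) := by
      intro k l
      by_cases hk : k = j
      · subst hk
        simpa using smoothOn_const _
      · simpa [Matrix.updateRow_ne hk, gMat] using hL.smooth_g k l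
    have h4 := smoothOn_det h3
    simp only [Matrix.adjugate_apply]
    exact h4
  refine ((h1.inv hL.det_ne).mul h2).congr fun x y _ => ?_
  simp only [gInv, Matrix.inv_def, Matrix.smul_apply, Ring.inverse_eq_inv', smul_eq_mul]
  rfl

theorem euler_g (hL : LocalFinsler U L) (i j : Fin n) : EulerOn U 0 (g L i j) := by
  have h1 := (hL.euler.sq hL.smooth hL.isOpen).dy hL.smooth_sq hL.isOpen j
  have h2 := (h1.dy (hL.smooth_dy_sq j) hL.isOpen i).const_mul
    ((hL.smooth_dy_sq j).dy hL.isOpen i) hL.isOpen (1 / 2)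
  intro x y hz
  have := h2 x y hz
  norm_num at this
  rw [zero_mul]
  exact this

/-- `∂̇_i L²` has degree one, so contracting its vertical derivatives with `y` returns it. -/
theorem agreeOn_yLow (hL : LocalFinsler U L) (i : Fin n) :
    AgreeOn U (fun x y => (1 / 2) * dy i (fun x y => L x y ^ 2) x y) (yLow L i) := by
  intro x y hz
  have h1 := (hL.euler.sq hL.smooth hL.isOpen).dy hL.smooth_sq hL.isOpen i x y hz
  have h2 : yLow L i x y =
      (1 / 2) * ∑ j, y j * dy j (dy i fun x y => L x y ^ 2) x y := by
    rw [yLow, Finset.mul_sum]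
    exact Finset.sum_congr rfl fun j _ => by rw [hL.g_symm hz i j, g]; ring
  rw [h2, h1]
  ring

theorem smooth_yLow (hL : LocalFinsler U L) (i : Fin n) : SmoothOn U (yLow L i) :=
  ((hL.smooth_dy_sq i).const_mul _).congr (hL.agreeOn_yLow i)

theorem yLow_eq (hL : LocalFinsler U L) (hz : (x, y) ∈ U) (i : Fin n) :
    yLow L i x y = L x y * dy i L x y := by
  refine (hL.agreeOn_yLow i x y hz).symm.trans ?_
  simp only [((hL.smooth.hasPd_dy hL.isOpen hz i).sq).dy_eq]
  ring

theorem dy_eq (hL : LocalFinsler U L) (hz : (x, y) ∈ U) (i : Fin n) :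
    dy i L x y = yLow L i x y / L x y := by
  rw [hL.yLow_eq hz, mul_div_cancel_left₀ _ (hL.pos x y hz).ne']

theorem hasPd_yLow_dy (hL : LocalFinsler U L) (hz : (x, y) ∈ U) (i j : Fin n) :
    HasPd (0, basisVec j) (yLow L i) x y (g L i j x y) :=
  ((((hL.smooth_dy_sq i).hasPd_dy hL.isOpen hz j).const_mul _).congr hL.isOpen hz
    (hL.agreeOn_yLow i)).of_eq (hL.g_symm hz j i)

theorem hasPd_g_dy (hL : LocalFinsler U L) (hz : (x, y) ∈ U) (i j k : Fin n) :
    HasPd (0, basisVec k) (g L i j) x y (2 * C L i j k x y) :=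
  ((hL.smooth_g i j).hasPd_dy hL.isOpen hz k).of_eq (by rw [C]; ring)

theorem sum_yLow_mul (hL : LocalFinsler U L) (hz : (x, y) ∈ U) :
    ∑ i, yLow L i x y * y i = L x y ^ 2 := by
  have h := hL.euler x y hz
  calc ∑ i, yLow L i x y * y i = L x y * ∑ i, y i * dy i L x y := by
        rw [Finset.mul_sum]
        exact Finset.sum_congr rfl fun i _ => by rw [hL.yLow_eq hz]; ring
    _ = _ := by rw [h]; ring

/-- The product rule applied to `y_j = L ∂̇_j L`. -/
theorem h_eq (hL : LocalFinsler U L) (hz : (x, y) ∈ U) (i j : Fin n) :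
    h L i j x y = g L i j x y - yLow L i x y * yLow L j x y / L x y ^ 2 := by
  have h1 : AgreeOn U (fun x y => L x y * dy j L x y) (yLow L j) :=
    fun x y hz => (hL.yLow_eq hz j).symm
  have h2 := ((hL.smooth.hasPd_dy hL.isOpen hz i).mul
    ((hL.smooth.dy hL.isOpen j).hasPd_dy hL.isOpen hz i)).congr hL.isOpen hz h1
  have h3 := h2.unique (hL.hasPd_yLow_dy hz j i)
  have h0 := (hL.pos x y hz).ne'
  rw [h, hL.g_symm hz i j, ← h3, hL.yLow_eq hz, hL.yLow_eq hz]
  field_simp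
  ring

theorem C_swap₁₂ (hL : LocalFinsler U L) (hz : (x, y) ∈ U) (i j k : Fin n) :
    C L i j k x y = C L j i k x y := by
  have h1 : AgreeOn U (g L i j) (g L j i) := fun x y hz => hL.g_symm hz i j
  have h2 := ((hL.hasPd_g_dy hz i j k).congr hL.isOpen hz h1).unique (hL.hasPd_g_dy hz j i k)
  linarith

/-- `C_{ijk}` is a quarter of the third vertical derivative of `L²`, so commuting derivatives gives
the symmetry; with `C_swap₁₂` it generates all permutations. -/
theorem C_swap₁₃ (hL : LocalFinsler U L) (hz : (x, y) ∈ U) (i j k : Fin n) :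
    C L i j k x y = C L k j i x y := by
  have h2 := (((hL.smooth_dy_sq j).dy hL.isOpen i).hasPd_dy hL.isOpen hz k).const_mul (1 / 2)
  have h3 := (((hL.smooth_dy_sq j).dy hL.isOpen k).hasPd_dy hL.isOpen hz i).const_mul (1 / 2)
  have h4 := h2.unique (hL.hasPd_g_dy hz i j k)
  have h5 := h3.unique (hL.hasPd_g_dy hz k j i)
  have h6 := (hL.smooth_dy_sq j).dy_comm hL.isOpen hz k i
  linarith

/-- Euler's relation for `g_{ij}`, which has degree zero. -/
theorem sum_C_mul (hL : LocalFinsler U L) (hz : (x, y) ∈ U) (i j : Fin n) :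
    ∑ k, C L i j k x y * y k = 0 := by
  have h1 := hL.euler_g i j x y hz
  calc ∑ k, C L i j k x y * y k = (1 / 2) * ∑ k, y k * dy k (g L i j) x y := by
        rw [Finset.mul_sum]
        exact Finset.sum_congr rfl fun k _ => by rw [C]; ring
    _ = 0 := by rw [h1]; ring

theorem sum_C_mul' (hL : LocalFinsler U L) (hz : (x, y) ∈ U) (j k : Fin n) :
    ∑ i, C L i j k x y * y i = 0 := by
  rw [← hL.sum_C_mul hz k j]
  exact Finset.sum_congr rfl fun i _ => by rw [hL.C_swap₁₃ hz]

/-- Derivatives of `y_i` in horizontal coordinate directions. -/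
theorem sum_dx_g_mul (hL : LocalFinsler U L) (hz : (x, y) ∈ U) (i k : Fin n) :
    ∑ j, dx k (g L i j) x y * y j = dx k (yLow L i) x y := by
  have h1 : HasPd (basisVec k, 0) (yLow L i) x y _ :=
    HasPd.sum Finset.univ fun j _ =>
      ((hL.smooth_g i j).hasPd_dx hL.isOpen hz k).mul (hasPd_coord _ j)
  rw [h1.dx_eq]
  simp

theorem dx_g_symm (hL : LocalFinsler U L) (hz : (x, y) ∈ U) (i j k : Fin n) :
    dx k (g L i j) x y = dx k (g L j i) x y :=
  ((((hL.smooth_g i j).hasPd_dx hL.isOpen hz k).congr hL.isOpen hz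
    fun _ _ hz => hL.g_symm hz i j).dx_eq).symm

theorem sum_dx_g_mul' (hL : LocalFinsler U L) (hz : (x, y) ∈ U) (i k : Fin n) :
    ∑ j, dx k (g L j i) x y * y j = dx k (yLow L i) x y := by
  rw [← hL.sum_dx_g_mul hz]
  exact Finset.sum_congr rfl fun j _ => by rw [hL.dx_g_symm hz]

theorem sum_dx_yLow_mul (hL : LocalFinsler U L) (hz : (x, y) ∈ U) (k : Fin n) :
    ∑ j, dx k (yLow L j) x y * y j = dx k (fun x y => L x y ^ 2) x y := by
  have h1 := HasPd.sum Finset.univ fun j (_ : j ∈ Finset.univ) =>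
      ((hL.smooth_yLow j).hasPd_dx hL.isOpen hz k).mul (hasPd_coord (basisVec k, 0) j)
  rw [(h1.congr hL.isOpen hz fun _ _ hz => hL.sum_yLow_mul hz).dx_eq]
  simp

/-- The spray with its index lowered. -/
theorem sum_g_G (hL : LocalFinsler U L) (hz : (x, y) ∈ U) (r : Fin n) :
    ∑ i, g L r i x y * G L i x y =
      (1 / 2) * ∑ j, y j * dx j (yLow L r) x y - (1 / 4) * dx r (fun x y => L x y ^ 2) x y := by
  have h1 : ∀ i, G L i x y = ∑ s, gInv L i s x y *
      ((1 / 4) * ∑ j, ∑ k, (dx j (g L k s) x y + dx k (g L j s) x y - dx s (g L j k) x y) *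
        y j * y k) := by
    intro i
    simp only [G, gammaSym, Finset.mul_sum, Finset.sum_mul]
    rw [Finset.sum_congr rfl fun j _ => Finset.sum_comm, Finset.sum_comm]
    exact Finset.sum_congr rfl fun s _ => Finset.sum_congr rfl fun j _ =>
      Finset.sum_congr rfl fun k _ => by ring
  simp only [h1]
  rw [hL.sum_g_gInv hz r fun s => (1 / 4) * ∑ j, ∑ k,
    (dx j (g L k s) x y + dx k (g L j s) x y - dx s (g L j k) x y) * y j * y k]
  have h2 : ∑ j, ∑ k, (dx j (g L k r) x y + dx k (g L j r) x y - dx r (g L j k) x y) * y j * y k =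
      ∑ j, (∑ k, dx j (g L k r) x y * y k) * y j + ∑ k, (∑ j, dx k (g L j r) x y * y j) * y k
        - ∑ j, (∑ k, dx r (g L j k) x y * y k) * y j := by
    have h3 : ∑ j, ∑ k, dx k (g L j r) x y * y j * y k =
        ∑ j, ∑ k, dx j (g L k r) x y * y k * y j := Finset.sum_comm
    have h4 : ∑ j, ∑ k, dx j (g L k r) x y * y j * y k =
        ∑ j, ∑ k, dx j (g L k r) x y * y k * y j :=
      Finset.sum_congr rfl fun j _ => Finset.sum_congr rfl fun k _ => mul_right_comm _ _ _
    have h5 : ∑ j, ∑ k, dx r (g L j k) x y * y j * y k =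
        ∑ j, ∑ k, dx r (g L j k) x y * y k * y j :=
      Finset.sum_congr rfl fun j _ => Finset.sum_congr rfl fun k _ => mul_right_comm _ _ _
    simp only [Finset.sum_mul, add_mul, sub_mul, Finset.sum_add_distrib,
      Finset.sum_sub_distrib, h3, h4, h5]
  rw [h2]
  simp only [hL.sum_dx_g_mul' hz, hL.sum_dx_g_mul hz, hL.sum_dx_yLow_mul hz]
  rw [Finset.sum_congr rfl fun j _ => mul_comm (y j) (dx j (yLow L r) x y)]
  ring

theorem smooth_G (hL : LocalFinsler U L) (i : Fin n) : SmoothOn U (G L i) := by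
  refine SmoothOn.const_mul _ (SmoothOn.sum _ fun j _ => SmoothOn.sum _ fun k _ =>
    (SmoothOn.mul ?_ (smoothOn_coord j)).mul (smoothOn_coord k))
  exact SmoothOn.const_mul _ (SmoothOn.sum _ fun r _ => (hL.smooth_gInv i r).mul
    ((((hL.smooth_g k r).dx hL.isOpen j).add ((hL.smooth_g j r).dx hL.isOpen k)).sub
      ((hL.smooth_g j k).dx hL.isOpen r)))

/-- The Barthel connection with its upper index lowered. -/
theorem sum_g_N (hL : LocalFinsler U L) (hz : (x, y) ∈ U) (r k : Fin n) :
    ∑ i, g L r i x y * N L i k x y =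
      (1 / 2) * (dx k (yLow L r) x y - dx r (yLow L k) x y + ∑ j, y j * dx j (g L r k) x y)
        - 2 * ∑ i, C L r i k x y * G L i x y := by
  have hU := hL.isOpen
  -- The identity `sum_g_G` is differentiated in `y^k`; its left side contributes `2 C_{rik} G^i +
  -- g_{ri} N^i_k`.
  have h1 := HasPd.sum Finset.univ fun i (_ : i ∈ Finset.univ) =>
    (hL.hasPd_g_dy hz r i k).mul ((hL.smooth_G i).hasPd_dy hU hz k)
  have h2 := ((HasPd.sum Finset.univ fun j (_ : j ∈ Finset.univ) =>
    (hasPd_coord (0, basisVec k) j).mul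
      (((hL.smooth_yLow r).dx hU j).hasPd_dy hU hz k)).const_mul (1 / 2)).sub
      (((hL.smooth_sq.dx hU r).hasPd_dy hU hz k).const_mul (1 / 4))
  have h3 := (h1.congr hU hz fun _ _ hz => hL.sum_g_G hz r).unique h2
  have h4 : ∀ j, dy k (dx j (yLow L r)) x y = dx j (g L r k) x y := by
    intro j
    rw [← (hL.smooth_yLow r).dx_dy_comm hU hz]
    exact (((((hL.smooth_yLow r).dy hU k).hasPd_dx hU hz j).congr hU hz
      fun _ _ hz => (hL.hasPd_yLow_dy hz r k).dy_eq).dx_eq).symm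
  have h5 : dy k (dx r fun x y => L x y ^ 2) x y = 2 * dx r (yLow L k) x y := by
    rw [← hL.smooth_sq.dx_dy_comm hU hz, ((((hL.smooth_dy_sq k).hasPd_dx hU hz r).const_mul
      (1 / 2)).congr hU hz (hL.agreeOn_yLow k)).dx_eq]
    ring
  simp only [h4, h5, basisVec_apply, Finset.sum_add_distrib, ite_mul, one_mul, zero_mul,
    Finset.sum_ite_eq', Finset.mem_univ, if_true] at h3
  simp only [N, Finset.mul_sum] at h3 ⊢
  simp only [mul_assoc] at h3
  linear_combination h3

/-- The spray has degree two. This is seen on the lowered forms: `C` annihilates `y`, and the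
remaining terms contract to twice the lowered spray. -/
theorem sum_N_mul (hL : LocalFinsler U L) (hz : (x, y) ∈ U) (i : Fin n) :
    ∑ k, N L i k x y * y k = 2 * G L i x y := by
  refine hL.eq_of_lower hz (X := fun i => ∑ k, N L i k x y * y k)
    (Y := fun i => 2 * G L i x y) (fun r => ?_) i
  have h1 : ∑ s, g L r s x y * ∑ k, N L s k x y * y k =
      ∑ k, (∑ s, g L r s x y * N L s k x y) * y k := by
    simp only [Finset.mul_sum, Finset.sum_mul]
    rw [Finset.sum_comm]
    exact Finset.sum_congr rfl fun j _ => Finset.sum_congr rfl fun k _ => by ring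
  have h2 : ∑ s, g L r s x y * (2 * G L s x y) = 2 * ∑ s, g L r s x y * G L s x y := by
    rw [Finset.mul_sum]
    exact Finset.sum_congr rfl fun k _ => by ring
  have h3 : ∑ k, (∑ j, y j * dx j (g L r k) x y) * y k = ∑ j, y j * dx j (yLow L r) x y := by
    simp only [Finset.sum_mul, ← hL.sum_dx_g_mul hz, Finset.mul_sum]
    rw [Finset.sum_comm]
    exact Finset.sum_congr rfl fun j _ => Finset.sum_congr rfl fun k _ => by ring
  have h4 : ∑ k, (∑ i, C L r i k x y * G L i x y) * y k = 0 := by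
    have : ∀ i, ∑ k, C L r i k x y * G L i x y * y k = 0 := fun i => by
      have := hL.sum_C_mul hz r i
      rw [Finset.sum_congr rfl fun k _ => mul_right_comm _ (G L i x y) (y k),
        ← Finset.sum_mul, this, zero_mul]
    simp only [Finset.sum_mul]
    rw [Finset.sum_comm]
    simp [this]
  have h5 := hL.sum_dx_yLow_mul hz r
  rw [h1, h2, hL.sum_g_G hz]
  simp only [hL.sum_g_N hz]
  have h6 : ∀ k, ((1 / 2) * (dx k (yLow L r) x y - dx r (yLow L k) x y +
      ∑ j, y j * dx j (g L r k) x y) - 2 * ∑ i, C L r i k x y * G L i x y) * y k =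
      (1 / 2) * (y k * dx k (yLow L r) x y) - (1 / 2) * (dx r (yLow L k) x y * y k)
      + (1 / 2) * ((∑ j, y j * dx j (g L r k) x y) * y k)
      - 2 * ((∑ i, C L r i k x y * G L i x y) * y k) := fun k => by ring
  simp only [h6, Finset.sum_add_distrib, Finset.sum_sub_distrib, ← Finset.mul_sum, h3, h4, h5]
  ring

/-- The nonlinear connection may come from a different function `L'`. This allows the new metric to
be differentiated along both the old and the new horizontal directions. -/
theorem delta_g (hL : LocalFinsler U L) (hz : (x, y) ∈ U) (L' : LocFun n) (i j k : Fin n) :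
    delta L' k (g L i j) x y =
      dx k (g L i j) x y - 2 * ∑ r, C L i j r x y * N L' r k x y := by
  rw [delta, Finset.mul_sum]
  congr 1
  exact Finset.sum_congr rfl fun r _ => by rw [(hL.hasPd_g_dy hz i j r).dy_eq]; ring

theorem sum_g_Gam (hL : LocalFinsler U L) (hz : (x, y) ∈ U) (r j k : Fin n) :
    ∑ i, g L r i x y * Gam L i j k x y =
      (1 / 2) * (delta L j (g L k r) x y + delta L k (g L j r) x y - delta L r (g L j k) x y) := by
  have h1 : ∀ i, Gam L i j k x y = ∑ s, gInv L i s x y * ((1 / 2) *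
      (delta L j (g L k s) x y + delta L k (g L j s) x y - delta L s (g L j k) x y)) := by
    intro i
    rw [Gam, Finset.mul_sum]
    exact Finset.sum_congr rfl fun s _ => by ring
  simp only [h1]
  exact hL.sum_g_gInv hz r fun s => (1 / 2) *
      (delta L j (g L k s) x y + delta L k (g L j s) x y - delta L s (g L j k) x y)

theorem delta_g_symm (hL : LocalFinsler U L) (hz : (x, y) ∈ U) (i j k : Fin n) (L' : LocFun n) :
    delta L' k (g L i j) x y = delta L' k (g L j i) x y :=
  ((((hL.smooth_g i j).hasPd_delta hL.isOpen hz L' k).congr hL.isOpen hz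
    fun _ _ hz => hL.g_symm hz i j).delta_eq).symm

theorem Gam_symm (hL : LocalFinsler U L) (hz : (x, y) ∈ U) (i j k : Fin n) :
    Gam L i j k x y = Gam L i k j x y := by
  refine hL.eq_of_lower hz (X := fun i => Gam L i j k x y) (Y := fun i => Gam L i k j x y)
    (fun r => ?_) i
  rw [hL.sum_g_Gam hz, hL.sum_g_Gam hz, hL.delta_g_symm hz j k r]
  ring

/-- The Cartan connection is metrical. -/
theorem delta_g_eq (hL : LocalFinsler U L) (hz : (x, y) ∈ U) (i j k : Fin n) :
    delta L k (g L i j) x y = ∑ r, g L j r x y * Gam L r i k x y +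
      ∑ r, g L i r x y * Gam L r j k x y := by
  rw [hL.sum_g_Gam hz, hL.sum_g_Gam hz, hL.delta_g_symm hz k j i, hL.delta_g_symm hz k i j,
    hL.delta_g_symm hz j i k]
  ring

/-- The Cartan connection has no deflection. In the lowered symbols, contraction with `y` kills
every `C N` term but one, in which `N^s_j y^j = 2 G^s` gives the `C G` term of `sum_g_N`. -/
theorem sum_Gam_mul (hL : LocalFinsler U L) (hz : (x, y) ∈ U) (i k : Fin n) :
    ∑ j, Gam L i j k x y * y j = N L i k x y := by
  refine hL.eq_of_lower hz (X := fun i => ∑ j, Gam L i j k x y * y j)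
    (Y := fun i => N L i k x y) (fun r => ?_) i
  have h1 : ∑ s, g L r s x y * ∑ j, Gam L s j k x y * y j =
      ∑ j, (∑ s, g L r s x y * Gam L s j k x y) * y j := by
    simp only [Finset.mul_sum, Finset.sum_mul]
    rw [Finset.sum_comm]
    exact Finset.sum_congr rfl fun j _ => Finset.sum_congr rfl fun k _ => by ring
  have h2 : ∀ a b : Fin n, ∑ j, (∑ s, C L j a s x y * N L s b x y) * y j = 0 := by
    intro a b
    have : ∀ s, ∑ j, C L j a s x y * N L s b x y * y j = 0 := fun s => by
      rw [Finset.sum_congr rfl fun k _ => mul_right_comm _ (N L s b x y) (y k),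
        ← Finset.sum_mul, hL.sum_C_mul' hz, zero_mul]
    simp only [Finset.sum_mul]
    rw [Finset.sum_comm]
    simp [this]
  have h3 : ∑ j, (∑ s, C L k r s x y * N L s j x y) * y j =
      2 * ∑ s, C L k r s x y * G L s x y := by
    simp only [Finset.sum_mul, Finset.mul_sum]
    rw [Finset.sum_comm]
    refine Finset.sum_congr rfl fun s _ => ?_
    rw [Finset.sum_congr rfl fun j _ => mul_assoc _ (N L s j x y) (y j), ← Finset.mul_sum,
      hL.sum_N_mul hz]
    ring
  have h4 : ∑ s, C L k r s x y * G L s x y = ∑ i, C L r i k x y * G L i x y :=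
    Finset.sum_congr rfl fun s _ => by
      rw [hL.C_swap₁₃ hz k r s, hL.C_swap₁₂ hz s r k]
  have h5 : ∑ j, dx j (g L k r) x y * y j = ∑ j, y j * dx j (g L r k) x y :=
    Finset.sum_congr rfl fun s _ => by rw [hL.dx_g_symm hz, mul_comm]
  rw [h1, hL.sum_g_N hz]
  simp only [hL.sum_g_Gam hz, hL.delta_g hz]
  have h6 : ∀ j, (1 / 2) * (dx j (g L k r) x y - 2 * ∑ s, C L k r s x y * N L s j x y +
      (dx k (g L j r) x y - 2 * ∑ s, C L j r s x y * N L s k x y) -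
      (dx r (g L j k) x y - 2 * ∑ s, C L j k s x y * N L s r x y)) * y j =
      (1 / 2) * (dx j (g L k r) x y * y j) - (∑ s, C L k r s x y * N L s j x y) * y j
      + (1 / 2) * (dx k (g L j r) x y * y j) - (∑ s, C L j r s x y * N L s k x y) * y j
      - (1 / 2) * (dx r (g L j k) x y * y j) + (∑ s, C L j k s x y * N L s r x y) * y j :=
    fun j => by ring
  simp only [h6, Finset.sum_add_distrib, Finset.sum_sub_distrib, ← Finset.mul_sum, h2, h3, h4, h5,
    hL.sum_dx_g_mul' hz]
  ring

/-- This says `y_{i|k} = 0`. The connection is metrical, and `δ_k y^j = -N^j_k` is compensated by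
`Γ^j_{rk} y^r = N^j_k`. -/
theorem hasPd_yLow_delta (hL : LocalFinsler U L) (hz : (x, y) ∈ U) (i k : Fin n) :
    HasPd (deltaVec L k x y) (yLow L i) x y (∑ r, yLow L r x y * Gam L r i k x y) := by
  have h1 : HasPd (deltaVec L k x y) (yLow L i) x y _ :=
    HasPd.sum Finset.univ fun j _ =>
      ((hL.smooth_g i j).hasPd_delta hL.isOpen hz L k).mul (hasPd_coord _ j)
  refine h1.of_eq ?_
  have h2 : ∑ j, (∑ r, g L i r x y * Gam L r j k x y) * y j = ∑ j, g L i j x y * N L j k x y := by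
    simp only [Finset.sum_mul]
    rw [Finset.sum_comm]
    simp only [mul_assoc, ← Finset.mul_sum, hL.sum_Gam_mul hz]
  have h3 : ∑ j, (∑ r, g L j r x y * Gam L r i k x y) * y j =
      ∑ r, yLow L r x y * Gam L r i k x y := by
    simp only [yLow, Finset.sum_mul]
    rw [Finset.sum_comm]
    exact Finset.sum_congr rfl fun r _ => Finset.sum_congr rfl fun j _ => by
      rw [hL.g_symm hz j r]; ring
  simp only [deltaVec_snd, hL.delta_g_eq hz, add_mul, mul_neg, Finset.sum_add_distrib,
    Finset.sum_neg_distrib, h2, h3]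
  ring

/-- Differentiating `L² = y_i y^i` horizontally, the Christoffel terms cancel and leave `2 L δ_k L =
0`. -/
theorem hasPd_delta_self (hL : LocalFinsler U L) (hz : (x, y) ∈ U) (k : Fin n) :
    HasPd (deltaVec L k x y) L x y 0 := by
  have h1 := HasPd.sum Finset.univ fun i (_ : i ∈ Finset.univ) =>
    (hL.hasPd_yLow_delta hz i k).mul (hasPd_coord (deltaVec L k x y) i)
  have h2 := (h1.congr hL.isOpen hz fun _ _ hz => hL.sum_yLow_mul hz).unique
    (hL.smooth.hasPd_delta hL.isOpen hz L k).sq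
  have h3 : ∑ i, (∑ r, yLow L r x y * Gam L r i k x y) * y i =
      ∑ r, yLow L r x y * N L r k x y := by
    simp only [Finset.sum_mul]
    rw [Finset.sum_comm]
    simp only [mul_assoc, ← Finset.mul_sum, hL.sum_Gam_mul hz]
  simp only [deltaVec_snd, mul_neg, Finset.sum_add_distrib, Finset.sum_neg_distrib, h3,
    add_neg_cancel] at h2
  refine (hL.smooth.hasPd_delta hL.isOpen hz L k).of_eq ?_
  have h0 := (hL.pos x y hz).ne'
  have : L x y * delta L k L x y = 0 := by linarith
  exact (mul_eq_zero.1 this).resolve_left h0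

end LocalFinsler

/-! ## Homogeneous functions of two real variables -/

section TwoVariables

variable {Ω : Set (ℝ × ℝ)} {F K : ℝ → ℝ → ℝ} {u v : ℝ}

theorem D1_eq_pd (hF : DifferentiableAt ℝ (fun w : ℝ × ℝ => F w.1 w.2) (u, v)) :
    D1 F u v = pd (1, 0) F u v := by
  have h1 : HasFDerivAt (fun s : ℝ => (s, v)) (.inl ℝ ℝ ℝ) u :=
    (hasFDerivAt_id u).prodMk (hasFDerivAt_const v u)
  have h2 := HasFDerivAt.comp u (f := fun s : ℝ => (s, v)) hF.hasFDerivAt h1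
  refine h2.hasDerivAt.deriv.trans ?_
  simp [pd]

theorem D2_eq_pd (hF : DifferentiableAt ℝ (fun w : ℝ × ℝ => F w.1 w.2) (u, v)) :
    D2 F u v = pd (0, 1) F u v := by
  have h1 : HasFDerivAt (fun t : ℝ => (u, t)) (.inr ℝ ℝ ℝ) v :=
    (hasFDerivAt_const u v).prodMk (hasFDerivAt_id v)
  have h2 := HasFDerivAt.comp v (f := fun t : ℝ => (u, t)) hF.hasFDerivAt h1
  refine h2.hasDerivAt.deriv.trans ?_
  simp [pd]

theorem HasPd.D1_eq {d : ℝ} (h₁ : HasPd (1, 0) F u v d) : D1 F u v = d :=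
  (D1_eq_pd h₁.1).trans h₁.2

theorem HasPd.D2_eq {d : ℝ} (h₁ : HasPd (0, 1) F u v d) : D2 F u v = d :=
  (D2_eq_pd h₁.1).trans h₁.2

theorem SmoothOn.hasPd_D1 (hF : SmoothOn Ω F) (hΩ : IsOpen Ω) (hw : (u, v) ∈ Ω) :
    HasPd (1, 0) F u v (D1 F u v) :=
  (hF.hasPd hΩ hw).of_eq (D1_eq_pd (hF.differentiableAt hΩ hw)).symm

theorem SmoothOn.hasPd_D2 (hF : SmoothOn Ω F) (hΩ : IsOpen Ω) (hw : (u, v) ∈ Ω) :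
    HasPd (0, 1) F u v (D2 F u v) :=
  (hF.hasPd hΩ hw).of_eq (D2_eq_pd (hF.differentiableAt hΩ hw)).symm

theorem SmoothOn.agreeOn_D1 (hF : SmoothOn Ω F) (hΩ : IsOpen Ω) :
    AgreeOn Ω (GenBetaConformal.pd (1, 0) F) (GenBetaConformal.D1 F) :=
  fun _ _ hw => (D1_eq_pd (hF.differentiableAt hΩ hw)).symm

theorem SmoothOn.agreeOn_D2 (hF : SmoothOn Ω F) (hΩ : IsOpen Ω) :
    AgreeOn Ω (GenBetaConformal.pd (0, 1) F) (GenBetaConformal.D2 F) :=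
  fun _ _ hw => (D2_eq_pd (hF.differentiableAt hΩ hw)).symm

theorem SmoothOn.D1 (hF : SmoothOn Ω F) (hΩ : IsOpen Ω) : SmoothOn Ω (D1 F) :=
  (hF.pd hΩ _).congr (hF.agreeOn_D1 hΩ)

theorem SmoothOn.D2 (hF : SmoothOn Ω F) (hΩ : IsOpen Ω) : SmoothOn Ω (D2 F) :=
  (hF.pd hΩ _).congr (hF.agreeOn_D2 hΩ)

theorem SmoothOn.D1_D2_comm (hF : SmoothOn Ω F) (hΩ : IsOpen Ω) (hw : (u, v) ∈ Ω) :
    GenBetaConformal.D1 (GenBetaConformal.D2 F) u v =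
      GenBetaConformal.D2 (GenBetaConformal.D1 F) u v := by
  rw [(((hF.pd hΩ _).hasPd hΩ hw).congr hΩ hw (hF.agreeOn_D2 hΩ)).D1_eq,
    (((hF.pd hΩ _).hasPd hΩ hw).congr hΩ hw (hF.agreeOn_D1 hΩ)).D2_eq, hF.pd_comm hΩ hw]

theorem hasPd_fst (a : ℝ × ℝ) : HasPd a (fun u _ : ℝ => u) u v a.1 :=
  ⟨differentiableAt_fst, (congrArg (fun l : ℝ × ℝ →L[ℝ] ℝ => l a) fderiv_fst)⟩

theorem hasPd_snd (a : ℝ × ℝ) : HasPd a (fun _ v : ℝ => v) u v a.2 :=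
  ⟨differentiableAt_snd, (congrArg (fun l : ℝ × ℝ →L[ℝ] ℝ => l a) fderiv_snd)⟩

/-- Euler's relation of degree `k` for `F(u, v)` on `Ω`. -/
def EulerOn₂ (Ω : Set (ℝ × ℝ)) (k : ℝ) (F : ℝ → ℝ → ℝ) : Prop :=
  ∀ u v, (u, v) ∈ Ω → u * D1 F u v + v * D2 F u v = k * F u v

theorem EulerOn₂.D1 {k : ℝ} (hE : EulerOn₂ Ω k F) (hF : SmoothOn Ω F) (hΩ : IsOpen Ω) :
    EulerOn₂ Ω (k - 1) (D1 F) := by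
  intro u v hw
  have h1 := ((hasPd_fst (1, 0)).mul ((hF.D1 hΩ).hasPd_D1 hΩ hw)).add
    ((hasPd_snd (1, 0)).mul ((hF.D2 hΩ).hasPd_D1 hΩ hw))
  have h2 := (h1.congr hΩ hw hE).unique ((hF.hasPd_D1 hΩ hw).const_mul k)
  rw [hF.D1_D2_comm hΩ hw] at h2
  linear_combination h2

theorem EulerOn₂.D2 {k : ℝ} (hE : EulerOn₂ Ω k F) (hF : SmoothOn Ω F) (hΩ : IsOpen Ω) :
    EulerOn₂ Ω (k - 1) (D2 F) := by
  intro u v hw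
  have h1 := ((hasPd_fst (0, 1)).mul ((hF.D1 hΩ).hasPd_D2 hΩ hw)).add
    ((hasPd_snd (0, 1)).mul ((hF.D2 hΩ).hasPd_D2 hΩ hw))
  have h2 := (h1.congr hΩ hw hE).unique ((hF.hasPd_D2 hΩ hw).const_mul k)
  rw [← hF.D1_D2_comm hΩ hw] at h2
  linear_combination h2

theorem EulerOn₂.mul {k l : ℝ} (hE : EulerOn₂ Ω k F) (hE' : EulerOn₂ Ω l K) (hF : SmoothOn Ω F)
    (hK : SmoothOn Ω K) (hΩ : IsOpen Ω) : EulerOn₂ Ω (k + l) fun u v => F u v * K u v := by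
  intro u v hw
  rw [((hF.hasPd_D1 hΩ hw).mul (hK.hasPd_D1 hΩ hw)).D1_eq,
    ((hF.hasPd_D2 hΩ hw).mul (hK.hasPd_D2 hΩ hw)).D2_eq]
  linear_combination K u v * hE u v hw + F u v * hE' u v hw

theorem EulerOn₂.add {k : ℝ} (hE : EulerOn₂ Ω k F) (hE' : EulerOn₂ Ω k K) (hF : SmoothOn Ω F)
    (hK : SmoothOn Ω K) (hΩ : IsOpen Ω) : EulerOn₂ Ω k fun u v => F u v + K u v := by
  intro u v hw
  rw [((hF.hasPd_D1 hΩ hw).add (hK.hasPd_D1 hΩ hw)).D1_eq,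
    ((hF.hasPd_D2 hΩ hw).add (hK.hasPd_D2 hΩ hw)).D2_eq]
  linear_combination hE u v hw + hE' u v hw

end TwoVariables

/-- The data `T` define a generalized `β`-conformal change between Finsler structures on `U`. -/
structure LocalHyp {n : ℕ} (U : Set (Coord n × Coord n)) (Ω : Set (ℝ × ℝ)) (T : LocalChange n) :
    Prop where
  fins : LocalFinsler U T.L
  finsBar : LocalFinsler U T.f0
  smooth_σ : SmoothOn U fun x _ => T.σ x
  smooth_b : ∀ i, SmoothOn U (T.bLow i)
  isOpen : IsOpen Ω
  smooth_f : SmoothOn Ω T.f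
  euler_f : EulerOn₂ Ω 1 T.f
  maps : ∀ x y, (x, y) ∈ U → (Real.exp (T.σ x) * T.L x y, T.β x y) ∈ Ω
  f1_ne : ∀ x y, (x, y) ∈ U → T.f1 x y ≠ 0

/-! ### Coefficients of the new metric: homogeneity identities and derivatives. -/

namespace LocalChange

variable {n : ℕ} (T : LocalChange n)

/-- The coefficient of `g_{ij}` in the new metric. -/
def cG : LocFun n := fun x y => T.eσ x y * T.p x y

/-- The coefficient of `b_i y_j + b_j y_i` in the new metric. -/
def cBY : LocFun n := fun x y => T.eσ x y * T.pm1 x y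

/-- The coefficient of `y_i y_j` in the new metric. -/
def cYY : LocFun n := fun x y => T.eσ x y * T.pm2 x y

end LocalChange

namespace LocalHyp

open LocalChange

variable {n : ℕ} {U : Set (Coord n × Coord n)} {Ω : Set (ℝ × ℝ)} {T : LocalChange n}
  {x y : Coord n} {v : Coord n × Coord n} {l s t : ℝ}

theorem L_ne (H : LocalHyp U Ω T) (hz : (x, y) ∈ U) : T.L x y ≠ 0 := (H.fins.pos x y hz).ne'

theorem f0_ne (H : LocalHyp U Ω T) (hz : (x, y) ∈ U) : T.f0 x y ≠ 0 := (H.finsBar.pos x y hz).ne'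

theorem eσ_ne : T.eσ x y ≠ 0 := Real.exp_ne_zero _

theorem p_ne (H : LocalHyp U Ω T) (hz : (x, y) ∈ U) : T.p x y ≠ 0 :=
  div_ne_zero (mul_ne_zero (H.f0_ne hz) (H.f1_ne x y hz)) (H.L_ne hz)

theorem cG_ne (H : LocalHyp U Ω T) (hz : (x, y) ∈ U) : T.cG x y ≠ 0 :=
  mul_ne_zero eσ_ne (H.p_ne hz)

theorem cG_mul (H : LocalHyp U Ω T) (hz : (x, y) ∈ U) :
    T.cG x y * T.L x y ^ 2 + T.q x y * T.β x y = T.f0 x y ^ 2 := by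
  have h1 := H.euler_f _ _ (H.maps x y hz)
  have h0 := H.L_ne hz
  change Real.exp (T.σ x) * T.L x y * T.f1 x y + T.β x y * T.f2 x y = 1 * T.f0 x y at h1
  simp only [cG, p, q, eσ]
  field_simp
  linear_combination T.f0 x y * h1

theorem cBY_mul (H : LocalHyp U Ω T) (hz : (x, y) ∈ U) :
    T.cBY x y * T.L x y ^ 2 + T.p0 x y * T.β x y = T.q x y := by
  have h1 := H.euler_f _ _ (H.maps x y hz)
  have h2 := H.euler_f.D2 H.smooth_f H.isOpen _ _ (H.maps x y hz)
  rw [H.smooth_f.D1_D2_comm H.isOpen (H.maps x y hz)] at h2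
  have h0 := H.L_ne hz
  have hf := H.f0_ne hz
  change Real.exp (T.σ x) * T.L x y * T.f1 x y + T.β x y * T.f2 x y = 1 * T.f0 x y at h1
  change Real.exp (T.σ x) * T.L x y * T.f12 x y + T.β x y * T.f22 x y = (1 - 1) * T.f2 x y at h2
  simp only [cBY, pm1, qm1, p0, q0, p, q, eσ]
  field_simp
  linear_combination T.f2 x y * h1 + T.f0 x y * h2

theorem cYY_mul (H : LocalHyp U Ω T) (hz : (x, y) ∈ U) :
    T.cYY x y * T.L x y ^ 2 = -(T.β x y * T.cBY x y) := by
  have h1 := H.euler_f _ _ (H.maps x y hz)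
  have h2 := H.euler_f.D1 H.smooth_f H.isOpen _ _ (H.maps x y hz)
  have h0 := H.L_ne hz
  have hf := H.f0_ne hz
  change Real.exp (T.σ x) * T.L x y * T.f1 x y + T.β x y * T.f2 x y = 1 * T.f0 x y at h1
  change Real.exp (T.σ x) * T.L x y * T.f11 x y + T.β x y * T.f12 x y = (1 - 1) * T.f1 x y at h2
  simp only [cBY, cYY, pm1, qm1, pm2, qm2, p, eσ]
  field_simp
  linear_combination T.f1 x y * h1 + T.f0 x y * h2

/-- A derivation applied to a function of `(e^σ L, β)` that satisfies Euler's relation. -/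
theorem hasPd_ev (H : LocalHyp U Ω T) (hz : (x, y) ∈ U) {K : ℝ → ℝ → ℝ} {k : ℝ}
    (hK : SmoothOn Ω K) (hE : EulerOn₂ Ω k K) (hl : HasPd v T.L x y (T.L x y * l))
    (hs : HasPd v (fun x _ => T.σ x) x y (s - l)) (ht : HasPd v T.β x y t) :
    HasPd v (T.ev K) x y
      ((k * T.ev K x y - T.β x y * T.ev (D2 K) x y) * s + T.ev (D2 K) x y * t) := by
  -- `l` and `s` are the logarithmic derivatives of `L` and of `e^σ L`, so the first argument
  -- changes by `e^σ L s`. Euler's relation then eliminates the first partial derivative of `K`.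
  have h1 := (hs.comp₁ (Real.hasDerivAt_exp _)).mul hl
  have hd := hK.differentiableAt H.isOpen (H.maps x y hz)
  have h2 := h1.comp ht hd
  refine HasPd.of_eq h2 ?_
  rw [← D1_eq_pd hd, ← D2_eq_pd hd]
  have h3 := hE _ _ (H.maps x y hz)
  simp only [ev]
  linear_combination s * h3

theorem hasPd_f0 (H : LocalHyp U Ω T) (hz : (x, y) ∈ U) (hl : HasPd v T.L x y (T.L x y * l))
    (hs : HasPd v (fun x _ => T.σ x) x y (s - l)) (ht : HasPd v T.β x y t) :
    HasPd v T.f0 x y ((T.f0 x y - T.β x y * T.f2 x y) * s + T.f2 x y * t) :=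
  (H.hasPd_ev hz H.smooth_f H.euler_f hl hs ht).of_eq (by rw [one_mul]; rfl)

theorem smooth_f2 (H : LocalHyp U Ω T) : SmoothOn Ω (D2 T.f) := H.smooth_f.D2 H.isOpen

theorem smooth_f22 (H : LocalHyp U Ω T) : SmoothOn Ω (D2 (D2 T.f)) := H.smooth_f2.D2 H.isOpen

theorem euler_f2 (H : LocalHyp U Ω T) : EulerOn₂ Ω (1 - 1) (D2 T.f) :=
  H.euler_f.D2 H.smooth_f H.isOpen

theorem euler_f22 (H : LocalHyp U Ω T) : EulerOn₂ Ω (1 - 1 - 1) (D2 (D2 T.f)) :=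
  H.euler_f2.D2 H.smooth_f2 H.isOpen

theorem hasPd_q (H : LocalHyp U Ω T) (hz : (x, y) ∈ U) (hl : HasPd v T.L x y (T.L x y * l))
    (hs : HasPd v (fun x _ => T.σ x) x y (s - l)) (ht : HasPd v T.β x y t) :
    HasPd v T.q x y ((T.q x y - T.β x y * T.p0 x y) * s + T.p0 x y * t) := by
  have hD : ev T (D2 fun u v => T.f u v * D2 T.f u v) x y = T.p0 x y := by
    rw [ev, ((H.smooth_f.hasPd_D2 H.isOpen (H.maps x y hz)).mul
      (H.smooth_f2.hasPd_D2 H.isOpen (H.maps x y hz))).D2_eq]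
    simp only [p0, q0, f0, f2, f22, ev]
    ring
  have h1 := H.hasPd_ev hz (H.smooth_f.mul H.smooth_f2)
    (H.euler_f.mul H.euler_f2 H.smooth_f H.smooth_f2 H.isOpen) hl hs ht
  rw [hD] at h1
  refine HasPd.of_eq h1 ?_
  simp only [q, f0, f2, ev]
  ring

theorem hasPd_p0 (H : LocalHyp U Ω T) (hz : (x, y) ∈ U) (hl : HasPd v T.L x y (T.L x y * l))
    (hs : HasPd v (fun x _ => T.σ x) x y (s - l)) (ht : HasPd v T.β x y t) :
    HasPd v T.p0 x y (T.p02 x y * (t - T.β x y * s)) := by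
  have h2 : EulerOn₂ Ω 0 fun u v => D2 T.f u v ^ 2 := by
    have := H.euler_f2.mul H.euler_f2 H.smooth_f2 H.smooth_f2 H.isOpen
    simpa only [← pow_two, sub_self, add_zero] using this
  have h3 : EulerOn₂ Ω 0 fun u v => T.f u v * D2 (D2 T.f) u v := by
    have := H.euler_f.mul H.euler_f22 H.smooth_f H.smooth_f22 H.isOpen
    simpa only [sub_self, zero_sub, add_neg_cancel] using this
  have h1 := H.hasPd_ev hz (H.smooth_f2.sq.add (H.smooth_f.mul H.smooth_f22))
    (h2.add h3 H.smooth_f2.sq (H.smooth_f.mul H.smooth_f22) H.isOpen) hl hs ht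
  refine HasPd.of_eq h1 ?_
  rw [p02]
  ring

/-- Here and in the next two lemmas the coefficient is differentiated through the quotient that the
homogeneity identities give for it, so `f₁₁` and `f₁₂` never have to be differentiated. -/
theorem hasPd_cG (H : LocalHyp U Ω T) (hz : (x, y) ∈ U) (hl : HasPd v T.L x y (T.L x y * l))
    (hs : HasPd v (fun x _ => T.σ x) x y (s - l)) (ht : HasPd v T.β x y t) :
    HasPd v T.cG x y ((2 * T.cG x y - T.β x y * T.cBY x y) * s + T.cBY x y * t
      - 2 * T.cG x y * l) := by
  have h0 := H.L_ne hz
  have h1 : AgreeOn U (fun x y => (T.f0 x y ^ 2 - T.q x y * T.β x y) / T.L x y ^ 2) T.cG :=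
    fun x y hz => by
      beta_reduce
      rw [← H.cG_mul hz, add_sub_cancel_right, mul_div_cancel_right₀ _ (pow_ne_zero 2 (H.L_ne hz))]
  have h2 := ((((H.hasPd_f0 hz hl hs ht).sq).sub ((H.hasPd_q hz hl hs ht).mul ht)).div
    hl.sq (pow_ne_zero 2 h0)).congr H.fins.isOpen hz h1
  refine h2.of_eq ?_
  have e1 := H.cG_mul hz
  have e2 := H.cBY_mul hz
  have e3 : T.q x y = T.f0 x y * T.f2 x y := rfl
  field_simp
  linear_combination (-2 * s + 2 * l) * e1 + (-t + T.β x y * s) * e2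
    + 2 * (T.β x y * s - t) * e3

theorem hasPd_cBY (H : LocalHyp U Ω T) (hz : (x, y) ∈ U) (hl : HasPd v T.L x y (T.L x y * l))
    (hs : HasPd v (fun x _ => T.σ x) x y (s - l)) (ht : HasPd v T.β x y t) :
    HasPd v T.cBY x y (T.cBY x y * s + T.β x y * T.p02 x y * (T.β x y * s - t) / T.L x y ^ 2
      - 2 * T.cBY x y * l) := by
  have h0 := H.L_ne hz
  have h1 : AgreeOn U (fun x y => (T.q x y - T.p0 x y * T.β x y) / T.L x y ^ 2) T.cBY :=
    fun x y hz => by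
      beta_reduce
      rw [← H.cBY_mul hz, add_sub_cancel_right,
        mul_div_cancel_right₀ _ (pow_ne_zero 2 (H.L_ne hz))]
  have h2 := ((((H.hasPd_q hz hl hs ht)).sub ((H.hasPd_p0 hz hl hs ht).mul ht)).div
    hl.sq (pow_ne_zero 2 h0)).congr H.fins.isOpen hz h1
  refine h2.of_eq ?_
  have e2 := H.cBY_mul hz
  field_simp
  linear_combination (- s + 2 * l) * e2

theorem hasPd_cYY (H : LocalHyp U Ω T) (hz : (x, y) ∈ U) (hl : HasPd v T.L x y (T.L x y * l))
    (hs : HasPd v (fun x _ => T.σ x) x y (s - l)) (ht : HasPd v T.β x y t) :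
    HasPd v T.cYY x y (T.cYY x y * (s - 4 * l) - T.cBY x y * t / T.L x y ^ 2 -
      T.β x y ^ 2 * T.p02 x y * (T.β x y * s - t) / T.L x y ^ 4) := by
  have h0 := H.L_ne hz
  have h1 : AgreeOn U (fun x y => (-1 * (T.β x y * T.cBY x y)) / T.L x y ^ 2) T.cYY :=
    fun x y hz => by
      beta_reduce
      rw [neg_one_mul, ← H.cYY_mul hz, mul_div_cancel_right₀ _ (pow_ne_zero 2 (H.L_ne hz))]
  have h2 := (((ht.mul (H.hasPd_cBY hz hl hs ht)).const_mul (-1)).div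
    hl.sq (pow_ne_zero 2 h0)).congr H.fins.isOpen hz h1
  refine h2.of_eq ?_
  have e2 := H.cYY_mul hz
  field_simp
  linear_combination (- s + 4 * l) * T.L x y ^ 2 * e2

/-! ### Vertical derivatives -/

theorem hasPd_L_dy (H : LocalHyp U Ω T) (hz : (x, y) ∈ U) (i : Fin n) :
    HasPd (0, basisVec i) T.L x y (T.L x y * (yLow T.L i x y / T.L x y ^ 2)) := by
  have h0 := H.L_ne hz
  refine (H.fins.smooth.hasPd_dy H.fins.isOpen hz i).of_eq ?_
  rw [H.fins.dy_eq hz]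
  field_simp

theorem hasPd_const_dy {F : Coord n → ℝ} (hF : SmoothOn U fun x _ : Coord n => F x)
    (hU : IsOpen U) (hz : (x, y) ∈ U) (i : Fin n) :
    HasPd (0, basisVec i) (fun x _ : Coord n => F x) x y 0 :=
  (hF.hasPd_dy hU hz i).of_eq (by simp [dy])

/-- The zero derivative is written as `s - l` to fit `hasPd_ev`: vertically `s = l = y_i / L²` and
`t = b_i`. -/
theorem hasPd_σ_dy (H : LocalHyp U Ω T) (hz : (x, y) ∈ U) (i : Fin n) :
    HasPd (0, basisVec i) (fun x _ => T.σ x) x y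
      (yLow T.L i x y / T.L x y ^ 2 - yLow T.L i x y / T.L x y ^ 2) :=
  (hasPd_const_dy H.smooth_σ H.fins.isOpen hz i).of_eq (sub_self _).symm

theorem hasPd_β_dy (H : LocalHyp U Ω T) (hz : (x, y) ∈ U) (i : Fin n) :
    HasPd (0, basisVec i) T.β x y (T.b i x) := by
  have h1 : HasPd (0, basisVec i) T.β x y _ := HasPd.sum Finset.univ fun j _ =>
    (hasPd_const_dy (H.smooth_b j) H.fins.isOpen hz i).mul (hasPd_coord _ j)
  exact h1.of_eq (by simp [basisVec_apply])

/-- The new supporting covector. -/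
theorem yLow_f0 (H : LocalHyp U Ω T) (hz : (x, y) ∈ U) (i : Fin n) :
    yLow T.f0 i x y = T.cG x y * yLow T.L i x y + T.q x y * T.b i x := by
  rw [H.finsBar.yLow_eq hz,
    (H.hasPd_f0 hz (H.hasPd_L_dy hz i) (H.hasPd_σ_dy hz i) (H.hasPd_β_dy hz i)).dy_eq]
  have e1 := H.cG_mul hz
  have e3 : T.q x y = T.f0 x y * T.f2 x y := rfl
  have h0 := H.L_ne hz
  field_simp
  linear_combination - yLow T.L i x y * e1 + (T.β x y * yLow T.L i x y - T.L x y ^ 2 * T.b i x) * e3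

/-- The new metric. -/
theorem g_f0 (H : LocalHyp U Ω T) (hz : (x, y) ∈ U) (i j : Fin n) :
    g T.f0 i j x y = T.cG x y * g T.L i j x y + T.p0 x y * T.b i x * T.b j x +
      T.cBY x y * (T.b i x * yLow T.L j x y + T.b j x * yLow T.L i x y) +
      T.cYY x y * yLow T.L i x y * yLow T.L j x y := by
  have hU := H.fins.isOpen
  -- The new metric is the vertical derivative of the new covector `ȳ_i = cG y_i + q b_i`.
  have h1 := ((H.hasPd_cG hz (H.hasPd_L_dy hz j) (H.hasPd_σ_dy hz j) (H.hasPd_β_dy hz j)).mul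
    (H.fins.hasPd_yLow_dy hz i j)).add ((H.hasPd_q hz (H.hasPd_L_dy hz j) (H.hasPd_σ_dy hz j)
      (H.hasPd_β_dy hz j)).mul (hasPd_const_dy (H.smooth_b i) hU hz j))
  have h2 := (H.finsBar.hasPd_yLow_dy hz i j).unique
    (h1.congr hU hz fun x y hz => (H.yLow_f0 hz i).symm)
  rw [h2]
  have e2 := H.cBY_mul hz
  have e3 := H.cYY_mul hz
  have h0 := H.L_ne hz
  field_simp
  linear_combination (-yLow T.L j x y * T.b i x) * e2 - yLow T.L i x y * yLow T.L j x y * e3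

/-- The new Cartan tensor. -/
theorem C_f0 (H : LocalHyp U Ω T) (hz : (x, y) ∈ U) (i j k : Fin n) :
    C T.f0 i j k x y = T.cG x y * C T.L i j k x y + T.V i j k x y := by
  have hU := H.fins.isOpen
  have hl := H.hasPd_L_dy hz k
  have hs := H.hasPd_σ_dy hz k
  have ht := H.hasPd_β_dy hz k
  have hb := fun i => hasPd_const_dy (H.smooth_b i) hU hz k
  have hy := fun i => H.fins.hasPd_yLow_dy hz i k
  have h1 := ((((H.hasPd_cG hz hl hs ht).mul (H.fins.hasPd_g_dy hz i j k)).add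
    (((H.hasPd_p0 hz hl hs ht).mul (hb i)).mul (hb j))).add
    ((H.hasPd_cBY hz hl hs ht).mul (((hb i).mul (hy j)).add ((hb j).mul (hy i))))).add
    (((H.hasPd_cYY hz hl hs ht).mul (hy i)).mul (hy j))
  have h2 := (H.finsBar.hasPd_g_dy hz i j k).unique
    (h1.congr hU hz fun x y hz => (H.g_f0 hz i j).symm)
  have e3 := H.cYY_mul hz
  have h0 := H.L_ne hz
  have e4 : T.cYY x y = -(T.β x y * T.cBY x y) / T.L x y ^ 2 := by
    rw [← e3, mul_div_cancel_right₀ _ (pow_ne_zero 2 h0)]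
  have h3 : C T.f0 i j k x y = (1 / 2) * (2 * C T.f0 i j k x y) := by ring
  rw [h3, h2, e4, V, H.fins.h_eq hz, H.fins.h_eq hz, H.fins.h_eq hz, H.fins.g_symm hz k i]
  simp only [m, cBY]
  field_simp
  ring

/-! ### Horizontal derivatives -/

/-- Horizontally the parameters of `hasPd_ev` are `l = 0`, `s = σ_k` and `t = b_{0|k}`. -/
theorem hasPd_L_delta (H : LocalHyp U Ω T) (hz : (x, y) ∈ U) (k : Fin n) :
    HasPd (deltaVec T.L k x y) T.L x y (T.L x y * 0) :=
  (H.fins.hasPd_delta_self hz k).of_eq (mul_zero _).symm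

theorem hasPd_σ_delta (H : LocalHyp U Ω T) (hz : (x, y) ∈ U) (k : Fin n) :
    HasPd (deltaVec T.L k x y) (fun x _ => T.σ x) x y (T.σLow k x y - 0) :=
  (H.smooth_σ.hasPd_delta H.fins.isOpen hz T.L k).of_eq (by simp [delta, σLow, dy])

theorem hasPd_b_delta (H : LocalHyp U Ω T) (hz : (x, y) ∈ U) (i k : Fin n) :
    HasPd (deltaVec T.L k x y) (T.bLow i) x y
      (T.bCov i k x y + ∑ r, T.b r x * Gam T.L r i k x y) :=
  ((H.smooth_b i).hasPd_delta H.fins.isOpen hz T.L k).of_eq (by simp [bCov, hCov, bLow])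

/-- The Christoffel term in `δ_k b_i`, contracted with `y`, cancels `δ_k y^i = -N^i_k`. -/
theorem hasPd_β_delta (H : LocalHyp U Ω T) (hz : (x, y) ∈ U) (k : Fin n) :
    HasPd (deltaVec T.L k x y) T.β x y (T.b0Cov k x y) := by
  have h1 : HasPd (deltaVec T.L k x y) T.β x y _ := HasPd.sum Finset.univ fun j _ =>
    (H.hasPd_b_delta hz j k).mul (hasPd_coord _ j)
  refine h1.of_eq ?_
  have h2 : ∑ j, (∑ r, T.b r x * Gam T.L r j k x y) * y j = ∑ r, T.b r x * N T.L r k x y := by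
    simp only [Finset.sum_mul]
    rw [Finset.sum_comm]
    simp only [mul_assoc, ← Finset.mul_sum, H.fins.sum_Gam_mul hz]
  simp only [deltaVec_snd, add_mul, Finset.sum_add_distrib, h2, b0Cov, bLow, mul_neg,
    Finset.sum_neg_distrib]
  ring

/-- The horizontal covariant derivative of the new metric with respect to the old connection. -/
theorem delta_g_f0 (H : LocalHyp U Ω T) (hz : (x, y) ∈ U) (i j k : Fin n) :
    delta T.L k (g T.f0 i j) x y = ∑ r, g T.f0 j r x y * Gam T.L r i k x y +
      ∑ r, g T.f0 i r x y * Gam T.L r j k x y + T.K i j x y * T.σLow k x y +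
      2 * T.B i j x y * T.b0Cov k x y + T.Q i x y * T.bCov j k x y +
      T.Q j x y * T.bCov i k x y := by
  have hU := H.fins.isOpen
  have hl := H.hasPd_L_delta hz k
  have hs := H.hasPd_σ_delta hz k
  have ht := H.hasPd_β_delta hz k
  have hb := fun i => H.hasPd_b_delta hz i k
  have hy := fun i => H.fins.hasPd_yLow_delta hz i k
  have hg := ((H.fins.smooth_g i j).hasPd_delta hU hz T.L k).of_eq (H.fins.delta_g_eq hz i j k)
  have h1 := ((((H.hasPd_cG hz hl hs ht).mul hg).add
    (((H.hasPd_p0 hz hl hs ht).mul (hb i)).mul (hb j))).add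
    ((H.hasPd_cBY hz hl hs ht).mul (((hb i).mul (hy j)).add ((hb j).mul (hy i))))).add
    (((H.hasPd_cYY hz hl hs ht).mul (hy i)).mul (hy j))
  rw [(h1.congr hU hz fun x y hz => (H.g_f0 hz i j).symm).delta_eq]
  -- The Christoffel terms from differentiating `g`, `b` and `y_i` reassemble into `ḡ Γ`. What is
  -- left comes from the scalar coefficients (giving `K` and `B`) and from `b_{i|k}` (giving `Q`).
  have h2 : ∀ i j, ∑ r, g T.f0 i r x y * Gam T.L r j k x y =
      T.cG x y * ∑ r, g T.L i r x y * Gam T.L r j k x y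
      + (T.p0 x y * T.b i x + T.cBY x y * yLow T.L i x y) * ∑ r, T.b r x * Gam T.L r j k x y
      + (T.cBY x y * T.b i x + T.cYY x y * yLow T.L i x y) *
        ∑ r, yLow T.L r x y * Gam T.L r j k x y := by
    intro i j
    simp only [Finset.mul_sum, ← Finset.sum_add_distrib]
    exact Finset.sum_congr rfl fun r _ => by rw [H.g_f0 hz]; ring
  rw [h2, h2]
  have e3 := H.cYY_mul hz
  have h0 := H.L_ne hz
  have e4 : T.cYY x y = -(T.β x y * T.cBY x y) / T.L x y ^ 2 := by
    rw [← e3, mul_div_cancel_right₀ _ (pow_ne_zero 2 h0)]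
  have e5 : T.A4 x y = T.cYY x y - T.β x y ^ 3 / T.L x y ^ 4 * T.p02 x y := rfl
  rw [K, e5, e4, B, H.fins.h_eq hz]
  simp only [m, bLow, cBY, cG, A1, A2, A3, Q]
  field_simp
  ring

end LocalHyp

namespace LocalHyp

open LocalChange

variable {n : ℕ} {U : Set (Coord n × Coord n)} {Ω : Set (ℝ × ℝ)} {T : LocalChange n}
  {x y : Coord n}

/-! ### The inverse metric -/

theorem sum_b_mul_bUp : ∑ i, T.b i x * T.bUp i x y = T.bSq x y :=
  Finset.sum_congr rfl fun _ _ => mul_comm _ _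

theorem sum_g_bUp (H : LocalHyp U Ω T) (hz : (x, y) ∈ U) (i : Fin n) :
    ∑ j, g T.L i j x y * T.bUp j x y = T.b i x :=
  H.fins.sum_g_gInv hz i fun j => T.b j x

theorem sum_yLow_raise (H : LocalHyp U Ω T) (hz : (x, y) ∈ U) (X : Fin n → ℝ) :
    ∑ i, yLow T.L i x y * ∑ j, gInv T.L i j x y * X j = ∑ j, X j * y j := by
  have h1 : ∀ i, yLow T.L i x y = ∑ j, y j * g T.L j i x y := fun i =>
    Finset.sum_congr rfl fun j _ => by rw [H.fins.g_symm hz i j, mul_comm]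
  simp only [h1]
  rw [Finset.sum_congr rfl fun i _ => Finset.sum_mul _ _ _, Finset.sum_comm]
  simp only [mul_assoc, ← Finset.mul_sum, H.fins.sum_g_gInv hz]
  exact Finset.sum_congr rfl fun _ _ => mul_comm _ _

theorem sum_b_raise (H : LocalHyp U Ω T) (hz : (x, y) ∈ U) (X : Fin n → ℝ) :
    ∑ i, T.b i x * ∑ j, gInv T.L i j x y * X j = ∑ j, X j * T.bUp j x y := by
  simp only [bUp, Finset.mul_sum]
  rw [Finset.sum_comm]
  exact Finset.sum_congr rfl fun i _ => Finset.sum_congr rfl fun j _ => by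
    rw [H.fins.gInv_symm hz i j]; ring

theorem sum_yLow_bUp (H : LocalHyp U Ω T) (hz : (x, y) ∈ U) :
    ∑ i, yLow T.L i x y * T.bUp i x y = T.β x y :=
  H.sum_yLow_raise hz fun j => T.b j x

theorem raise_yLow (H : LocalHyp U Ω T) (hz : (x, y) ∈ U) (i : Fin n) :
    ∑ j, gInv T.L i j x y * yLow T.L j x y = y i :=
  H.fins.sum_gInv_g hz i fun j => y j

theorem raise_m (H : LocalHyp U Ω T) (hz : (x, y) ∈ U) (i : Fin n) :
    ∑ j, gInv T.L i j x y * T.m j x y = T.bUp i x y - T.β x y / T.L x y ^ 2 * y i := by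
  rw [← H.raise_yLow hz i, bUp, Finset.mul_sum, ← Finset.sum_sub_distrib]
  exact Finset.sum_congr rfl fun j _ => by rw [m]; ring

theorem sum_m_mul (H : LocalHyp U Ω T) (hz : (x, y) ∈ U) : ∑ i, T.m i x y * y i = 0 := by
  have h0 := H.L_ne hz
  simp only [m, sub_mul, Finset.sum_sub_distrib, mul_assoc, ← Finset.mul_sum,
    H.fins.sum_yLow_mul hz]
  rw [div_mul_cancel₀ _ (pow_ne_zero 2 h0), β, sub_self]

theorem sum_m_bUp (H : LocalHyp U Ω T) (hz : (x, y) ∈ U) :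
    ∑ i, T.m i x y * T.bUp i x y = T.mSq x y := by
  have h1 : T.mSq x y = ∑ i, T.m i x y * ∑ j, gInv T.L i j x y * T.m j x y := by
    simp only [mSq, Finset.mul_sum]
    exact Finset.sum_congr rfl fun i _ => Finset.sum_congr rfl fun j _ => by ring
  have h2 := H.sum_m_mul hz
  rw [h1]
  simp only [H.raise_m hz, mul_sub, Finset.sum_sub_distrib,
    mul_left_comm (T.m _ x y) (T.β x y / T.L x y ^ 2), ← Finset.mul_sum, h2]
  ring

/-- Pythagoras: `m` is the part of `b` that is `g`-orthogonal to `y`. -/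
theorem bSq_eq (H : LocalHyp U Ω T) (hz : (x, y) ∈ U) :
    T.bSq x y = T.mSq x y + T.β x y ^ 2 / T.L x y ^ 2 := by
  rw [← H.sum_m_bUp hz, ← sum_b_mul_bUp]
  simp only [m, sub_mul, Finset.sum_sub_distrib, mul_assoc, ← Finset.mul_sum, H.sum_yLow_bUp hz]
  ring

/-- `ε` in terms of the coefficients of the new metric. -/
theorem ε_eq (H : LocalHyp U Ω T) (hz : (x, y) ∈ U) :
    T.ε x y = T.cG x y * T.f0 x y ^ 2 / T.L x y ^ 2 +
      T.mSq x y * (T.p0 x y * T.cG x y - T.q x y * T.cBY x y) := by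
  have h0 := H.L_ne hz
  have e1 := H.cG_mul hz
  have e2 := H.cBY_mul hz
  have e3 : T.q x y = T.f0 x y * T.f2 x y := rfl
  rw [ε, show T.eσ x y * T.p x y = T.cG x y from rfl,
    show T.q0 x y = T.p0 x y - T.f2 x y ^ 2 by rw [p0]; ring]
  field_simp
  linear_combination (-T.mSq x y * T.p0 x y) * e1 + T.mSq x y * T.q x y * e2
    + T.mSq x y * (T.q x y + T.f0 x y * T.f2 x y) * e3

theorem sum_g_f0_mul (H : LocalHyp U Ω T) (hz : (x, y) ∈ U) (i : Fin n) (Z : Fin n → ℝ) :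
    ∑ r, g T.f0 i r x y * Z r = T.cG x y * ∑ r, g T.L i r x y * Z r +
      (T.p0 x y * T.b i x + T.cBY x y * yLow T.L i x y) * ∑ r, T.b r x * Z r +
      (T.cBY x y * T.b i x + T.cYY x y * yLow T.L i x y) * ∑ r, yLow T.L r x y * Z r := by
  simp only [Finset.mul_sum, ← Finset.sum_add_distrib]
  exact Finset.sum_congr rfl fun r _ => by rw [H.g_f0 hz]; ring

theorem cYY_eq (H : LocalHyp U Ω T) (hz : (x, y) ∈ U) :
    T.cYY x y = -(T.β x y * T.cBY x y) / T.L x y ^ 2 := by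
  rw [← H.cYY_mul hz, mul_div_cancel_right₀ _ (pow_ne_zero 2 (H.L_ne hz))]

/-- If `ε = 0`, the vector `f² b^i - (f² β / L² + q m²) y^i` lies in the kernel of the new metric,
hence vanishes. Contracting it with `m_i` gives `f² m² = 0`, so `m² = 0`; but then `ε = cG f² / L²`,
which is nonzero. -/
theorem ε_ne (H : LocalHyp U Ω T) (hz : (x, y) ∈ U) : T.ε x y ≠ 0 := by
  intro he
  have h0 := H.L_ne hz
  have e1 := H.cG_mul hz
  have e2 := H.cBY_mul hz
  have e4 := H.ε_eq hz
  have e5 := H.cYY_eq hz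
  have e6 := H.bSq_eq hz
  have h1 : ∀ i, T.f0 x y ^ 2 * T.bUp i x y -
      (T.f0 x y ^ 2 * (T.β x y / T.L x y ^ 2) + T.q x y * T.mSq x y) * y i = 0 := by
    refine H.finsBar.eq_of_lower hz (X := fun i => T.f0 x y ^ 2 * T.bUp i x y -
      (T.f0 x y ^ 2 * (T.β x y / T.L x y ^ 2) + T.q x y * T.mSq x y) * y i)
      (Y := fun _ => 0) fun r => ?_
    rw [H.sum_g_f0_mul hz]
    simp only [mul_sub, Finset.sum_sub_distrib, mul_zero, Finset.sum_const_zero]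
    simp only [mul_left_comm _ (T.f0 x y ^ 2), ← Finset.mul_sum, H.sum_g_bUp hz,
      sum_b_mul_bUp, H.sum_yLow_bUp hz]
    simp only [mul_left_comm _ (T.f0 x y ^ 2 * (T.β x y / T.L x y ^ 2) + T.q x y * T.mSq x y),
      ← Finset.mul_sum, H.fins.sum_yLow_mul hz]
    rw [show ∑ j, g T.L r j x y * y j = yLow T.L r x y from rfl,
      show ∑ j, T.b j x * y j = T.β x y from rfl, e5, e6]
    rw [he, ← e1, ← e2] at e4
    rw [← e1, ← e2]
    field_simp at e4 ⊢
    linear_combination (-(T.L x y ^ 2 * T.b r x) + T.β x y * yLow T.L r x y) * e4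
  have h2 : T.f0 x y ^ 2 * T.mSq x y = 0 := by
    have h3 : ∑ i, T.m i x y * (T.f0 x y ^ 2 * T.bUp i x y -
      (T.f0 x y ^ 2 * (T.β x y / T.L x y ^ 2) + T.q x y * T.mSq x y) * y i) = 0 := by
      simp only [h1, mul_zero, Finset.sum_const_zero]
    simp only [mul_sub, Finset.sum_sub_distrib, mul_left_comm (T.m _ x y), ← Finset.mul_sum,
      H.sum_m_mul hz, H.sum_m_bUp hz] at h3
    linarith
  have hm : T.mSq x y = 0 := (mul_eq_zero.1 h2).resolve_left (pow_ne_zero 2 (H.f0_ne hz))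
  rw [he, hm, zero_mul, add_zero] at e4
  exact (div_ne_zero (mul_ne_zero (H.cG_ne hz) (pow_ne_zero 2 (H.f0_ne hz)))
    (pow_ne_zero 2 h0)) e4.symm

/-- This and the next two lemmas rewrite the `s` coefficients in terms of the coefficients of the
new metric and `ε`, so that later verifications are rational identities in few quantities. -/
theorem s0_eq (H : LocalHyp U Ω T) (hz : (x, y) ∈ U) :
    T.s0 x y = (T.p0 x y * T.cG x y - T.q x y * T.cBY x y) / (T.cG x y * T.ε x y) := by
  have h0 := H.L_ne hz
  have e1 := H.cG_mul hz
  have e2 := H.cBY_mul hz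
  have e3 : T.q x y = T.f0 x y * T.f2 x y := rfl
  have hε := H.ε_ne hz
  have hp := H.p_ne hz
  have hs : T.eσ x y ≠ 0 := eσ_ne
  rw [s0, show T.q0 x y = T.p0 x y - T.f2 x y ^ 2 by rw [p0]; ring]
  have hc : T.cG x y = T.eσ x y * T.p x y := rfl
  rw [hc] at e1 ⊢
  field_simp
  linear_combination (-T.p0 x y) * e1 + T.q x y * e2
    + (T.q x y + T.f0 x y * T.f2 x y) * e3

theorem sm1_eq (H : LocalHyp U Ω T) (hz : (x, y) ∈ U) :
    T.sm1 x y = T.cBY x y * T.f0 x y ^ 2 / (T.cG x y * T.ε x y * T.L x y ^ 2) := by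
  have h0 := H.L_ne hz
  have hε := H.ε_ne hz
  have hp := H.p_ne hz
  have hs : T.eσ x y ≠ 0 := eσ_ne
  rw [sm1, cBY, cG]
  field_simp

/-- A single formula for both branches of `sm2`: where `β ≠ 0`, the factor `β` cancels by `bSq_eq`
and `cG_mul`. -/
theorem sm2_eq (H : LocalHyp U Ω T) (hz : (x, y) ∈ U) :
    T.sm2 x y = -(T.cBY x y * (T.q x y * T.mSq x y + T.β x y * T.f0 x y ^ 2 / T.L x y ^ 2)) /
      (T.cG x y * T.ε x y * T.L x y ^ 2) := by
  have h0 := H.L_ne hz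
  have hε := H.ε_ne hz
  have hp := H.p_ne hz
  have hs : T.eσ x y ≠ 0 := eσ_ne
  have e1 := H.cG_mul hz
  rw [sm2, cBY, cG]
  split_ifs with hβ
  · rw [hβ]
    field_simp
    ring
  · rw [H.bSq_eq hz]
    rw [cG] at e1
    field_simp
    linear_combination T.pm1 x y * T.mSq x y * T.L x y ^ 2 * e1

theorem newInv_mul (T : LocalChange n) (x y : Coord n) (i : Fin n) (W : Fin n → ℝ) :
    ∑ r, T.newInv i r x y * W r = (T.cG x y)⁻¹ * ∑ r, gInv T.L i r x y * W r -
      (T.s0 x y * T.bUp i x y + T.sm1 x y * y i) * ∑ r, W r * T.bUp r x y -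
      (T.sm1 x y * T.bUp i x y + T.sm2 x y * y i) * ∑ r, W r * y r := by
  simp only [Finset.mul_sum, ← Finset.sum_sub_distrib]
  refine Finset.sum_congr rfl fun r _ => ?_
  rw [newInv, cG, mul_inv, div_eq_mul_inv]
  ring

theorem sum_g_f0_newInv (H : LocalHyp U Ω T) (hz : (x, y) ∈ U) (i : Fin n) (W : Fin n → ℝ) :
    ∑ r, g T.f0 i r x y * ∑ s, T.newInv r s x y * W s = W i := by
  rw [H.sum_g_f0_mul hz]
  simp only [newInv_mul, mul_sub, Finset.sum_sub_distrib]
  have e : ∀ (Z : Fin n → ℝ) (c d k : ℝ), ∑ r, Z r * ((c * T.bUp r x y + d * y r) * k) =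
      k * (c * ∑ r, Z r * T.bUp r x y + d * ∑ r, Z r * y r) := by
    intro Z c d k
    simp only [Finset.mul_sum, ← Finset.sum_add_distrib]
    exact Finset.sum_congr rfl fun r _ => by ring
  simp only [e, mul_left_comm _ (T.cG x y)⁻¹, ← Finset.mul_sum, H.fins.sum_g_gInv hz,
    H.sum_b_raise hz, H.sum_yLow_raise hz, H.sum_g_bUp hz, sum_b_mul_bUp, H.sum_yLow_bUp hz,
    H.fins.sum_yLow_mul hz]
  rw [show ∑ j, g T.L i j x y * y j = yLow T.L i x y from rfl,
      show ∑ j, T.b j x * y j = T.β x y from rfl]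
  have h0 := H.L_ne hz
  have hP := H.cG_ne hz
  have hε := H.ε_ne hz
  have e4 := H.ε_eq hz
  rw [H.s0_eq hz, H.sm1_eq hz, H.sm2_eq hz, H.cYY_eq hz, H.bSq_eq hz]
  rw [← H.cG_mul hz, ← H.cBY_mul hz] at e4 ⊢
  -- The covector `W` now enters only through its contractions with `b^r` and `y^r`; their
  -- coefficients vanish by the formula for `ε`.
  generalize ∑ r, W r * T.bUp r x y = wb
  generalize ∑ r, W r * y r = wy
  generalize T.ε x y = ε at *
  field_simp at e4 ⊢
  linear_combination (T.L x y ^ 2 * (wb * T.p0 x y * T.b i x + wb * T.cBY x y * yLow T.L i x y +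
    T.cBY x y * T.b i x * wy) - T.cBY x y * T.β x y * yLow T.L i x y * wy) * e4

/-- Each of the differences of sprays, Barthel connections and Cartan connections is solved for with
this. -/
theorem sum_newInv_g_f0 (H : LocalHyp U Ω T) (hz : (x, y) ∈ U) {X W : Fin n → ℝ}
    (h : ∀ r, ∑ s, g T.f0 r s x y * X s = W r) (i : Fin n) :
    X i = ∑ r, T.newInv i r x y * W r := by
  refine H.finsBar.eq_of_lower hz (X := X) (Y := fun i => ∑ r, T.newInv i r x y * W r)
    (fun r => ?_) i
  rw [h, H.sum_g_f0_newInv hz]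

/-- The inverse of the new metric. -/
theorem gInv_f0 (H : LocalHyp U Ω T) (hz : (x, y) ∈ U) (i r : Fin n) :
    gInv T.f0 i r x y = T.newInv i r x y := by
  have h := H.sum_newInv_g_f0 hz (X := fun i => ∑ s, gInv T.f0 i s x y * if s = r then 1 else 0)
    (fun s => H.finsBar.sum_g_gInv hz s fun s => if s = r then 1 else 0) i
  simpa using h

end LocalHyp

namespace LocalChange

variable {n : ℕ} (T : LocalChange n)

/-- `K_{i0} = K_{ij} y^j`. -/
def Ky (i : Fin n) : LocFun n := fun x y =>
  2 * T.cG x y * yLow T.L i x y + T.L x y ^ 2 * T.cBY x y * T.m i x y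

/-- The covariant derivative of the new metric with respect to the old connection. -/
def gCov (i j k : Fin n) : LocFun n := fun x y =>
  T.K i j x y * T.σLow k x y + 2 * T.B i j x y * T.b0Cov k x y +
    T.Q i x y * T.bCov j k x y + T.Q j x y * T.bCov i k x y

end LocalChange

namespace LocalHyp

open LocalChange

variable {n : ℕ} {U : Set (Coord n × Coord n)} {Ω : Set (ℝ × ℝ)} {T : LocalChange n}
  {x y : Coord n}

/-! ### Contractions with the supporting element -/

theorem K_symm (H : LocalHyp U Ω T) (hz : (x, y) ∈ U) (i j : Fin n) :
    T.K i j x y = T.K j i x y := by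
  rw [K, K, H.fins.g_symm hz i j]
  ring

theorem h_symm (H : LocalHyp U Ω T) (hz : (x, y) ∈ U) (i j : Fin n) :
    h T.L i j x y = h T.L j i x y := by
  rw [H.fins.h_eq hz, H.fins.h_eq hz, H.fins.g_symm hz i j, mul_comm (yLow T.L i x y)]

theorem B_symm (H : LocalHyp U Ω T) (hz : (x, y) ∈ U) (i j : Fin n) :
    T.B i j x y = T.B j i x y := by
  rw [B, B, H.h_symm hz i j]
  ring

theorem gCov_symm (H : LocalHyp U Ω T) (hz : (x, y) ∈ U) (i j k : Fin n) :
    T.gCov i j k x y = T.gCov j i k x y := by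
  rw [gCov, gCov, H.K_symm hz i j, H.B_symm hz i j]
  ring

theorem sum_K_mul (H : LocalHyp U Ω T) (hz : (x, y) ∈ U) (i : Fin n) :
    ∑ j, T.K i j x y * y j = T.Ky i x y := by
  have h0 := H.L_ne hz
  have h1 : ∑ j, T.K i j x y * y j = T.A1 x y * ∑ j, g T.L i j x y * y j +
      (T.A2 x y * T.b i x + T.A3 x y * yLow T.L i x y) * ∑ j, T.b j x * y j +
      (T.A3 x y * T.b i x + T.A4 x y * yLow T.L i x y) * ∑ j, yLow T.L j x y * y j := by
    simp only [Finset.mul_sum, ← Finset.sum_add_distrib]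
    exact Finset.sum_congr rfl fun j _ => by rw [K]; ring
  rw [h1, H.fins.sum_yLow_mul hz, show ∑ j, g T.L i j x y * y j = yLow T.L i x y from rfl,
    show ∑ j, T.b j x * y j = T.β x y from rfl,
    show T.A4 x y = T.cYY x y - T.β x y ^ 3 / T.L x y ^ 4 * T.p02 x y from rfl, H.cYY_eq hz]
  simp only [A1, A2, A3, Ky, m, cG, cBY]
  field_simp
  ring

theorem sum_Ky_mul (H : LocalHyp U Ω T) (hz : (x, y) ∈ U) :
    ∑ j, T.Ky j x y * y j = 2 * T.cG x y * T.L x y ^ 2 := by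
  simp only [Ky, add_mul, mul_assoc, Finset.sum_add_distrib, ← Finset.mul_sum,
    H.fins.sum_yLow_mul hz, H.sum_m_mul hz]
  ring

theorem sum_B_mul (H : LocalHyp U Ω T) (hz : (x, y) ∈ U) (i : Fin n) :
    ∑ j, T.B i j x y * y j = 0 := by
  have h0 := H.L_ne hz
  have h1 : ∑ j, T.B i j x y * y j = (1 / 2) * (T.cBY x y * (∑ j, g T.L i j x y * y j -
      yLow T.L i x y / T.L x y ^ 2 * ∑ j, yLow T.L j x y * y j) +
      T.p02 x y * T.m i x y * ∑ j, T.m j x y * y j) := by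
    simp only [Finset.mul_sum, ← Finset.sum_add_distrib, ← Finset.sum_sub_distrib]
    exact Finset.sum_congr rfl fun j _ => by rw [B, H.fins.h_eq hz, cBY]; ring
  rw [h1, H.fins.sum_yLow_mul hz, H.sum_m_mul hz,
    show ∑ j, g T.L i j x y * y j = yLow T.L i x y from rfl]
  field_simp
  ring

theorem sum_Q_mul (H : LocalHyp U Ω T) (hz : (x, y) ∈ U) :
    ∑ j, T.Q j x y * y j = T.q x y := by
  rw [← H.cBY_mul hz]
  simp only [Q, add_mul, mul_assoc, Finset.sum_add_distrib, ← Finset.mul_sum,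
    H.fins.sum_yLow_mul hz, β, cBY]

theorem sum_bCov_mul (T : LocalChange n) (x y : Coord n) (i : Fin n) :
    ∑ j, T.bCov i j x y * y j = T.E0 i x y + T.F0 i x y := by
  rw [E0, F0, ← Finset.sum_add_distrib]
  exact Finset.sum_congr rfl fun j _ => by rw [E, F]; ring

theorem b0Cov_eq (T : LocalChange n) (x y : Coord n) (k : Fin n) :
    T.b0Cov k x y = T.E0 k x y - T.F0 k x y := by
  rw [E0, F0, b0Cov, ← Finset.sum_sub_distrib]
  exact Finset.sum_congr rfl fun j _ => by rw [E, F]; ring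

theorem sum_F0_mul (T : LocalChange n) (x y : Coord n) : ∑ i, T.F0 i x y * y i = 0 := by
  have h1 : ∑ i, T.F0 i x y * y i = -∑ i, T.F0 i x y * y i := by
    conv_lhs => simp only [F0, Finset.sum_mul]
    rw [Finset.sum_comm, ← Finset.sum_neg_distrib]
    refine Finset.sum_congr rfl fun j _ => ?_
    rw [F0, Finset.sum_mul, ← Finset.sum_neg_distrib]
    exact Finset.sum_congr rfl fun i _ => by rw [F, F]; ring
  linarith

theorem sum_b0Cov_mul (T : LocalChange n) (x y : Coord n) :
    ∑ k, T.b0Cov k x y * y k = T.E00 x y := by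
  simp only [b0Cov_eq, sub_mul, Finset.sum_sub_distrib, sum_F0_mul, sub_zero, E00]

/-! ### Difference of the connections -/

/-- The symbols of the first kind of the difference of the Cartan connections. -/
theorem sum_g_f0_Gam_sub (H : LocalHyp U Ω T) (hz : (x, y) ∈ U) (r j k : Fin n) :
    ∑ s, g T.f0 r s x y * (Gam T.f0 s j k x y - Gam T.L s j k x y) =
      (1 / 2) * (T.gCov k r j x y + T.gCov j r k x y - T.gCov j k r x y)
      - ∑ s, C T.f0 k r s x y * (N T.f0 s j x y - N T.L s j x y)
      - ∑ s, C T.f0 j r s x y * (N T.f0 s k x y - N T.L s k x y)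
      + ∑ s, C T.f0 j k s x y * (N T.f0 s r x y - N T.L s r x y) := by
  -- The new and old `δ_k` differ by `-(N̄ - N)^s_k ∂̇_s`, and the vertical derivative of the new
  -- metric is twice its Cartan tensor.
  have h1 : ∀ i j k, delta T.f0 k (g T.f0 i j) x y = ∑ r, g T.f0 j r x y * Gam T.L r i k x y +
      ∑ r, g T.f0 i r x y * Gam T.L r j k x y + T.gCov i j k x y
      - 2 * ∑ s, C T.f0 i j s x y * (N T.f0 s k x y - N T.L s k x y) := by
    intro i j k
    have h2 := H.finsBar.delta_g hz T.f0 i j k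
    have h3 := H.finsBar.delta_g hz T.L i j k
    rw [H.delta_g_f0 hz] at h3
    simp only [mul_sub, Finset.sum_sub_distrib, gCov]
    linarith
  have h4 : ∀ r j k, ∑ s, g T.f0 r s x y * Gam T.L s j k x y =
      ∑ s, g T.f0 r s x y * Gam T.L s k j x y := fun r j k =>
    Finset.sum_congr rfl fun s _ => by rw [H.fins.Gam_symm hz]
  simp only [mul_sub, Finset.sum_sub_distrib, H.finsBar.sum_g_Gam hz, h1]
  rw [h4 r k j, h4 k r j, h4 j r k]
  ring

theorem sum_gCov_mul (H : LocalHyp U Ω T) (hz : (x, y) ∈ U) (r k : Fin n) :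
    ∑ j, T.gCov r j k x y * y j = T.Ky r x y * T.σLow k x y + T.q x y * T.bCov r k x y +
      T.Q r x y * T.b0Cov k x y := by
  have h1 : ∑ j, T.gCov r j k x y * y j = T.σLow k x y * ∑ j, T.K r j x y * y j +
      2 * T.b0Cov k x y * ∑ j, T.B r j x y * y j + T.bCov r k x y * ∑ j, T.Q j x y * y j +
      T.Q r x y * ∑ j, T.bCov j k x y * y j := by
    simp only [Finset.mul_sum, ← Finset.sum_add_distrib]
    exact Finset.sum_congr rfl fun j _ => by rw [gCov]; ring
  rw [h1, H.sum_K_mul hz, H.sum_B_mul hz, H.sum_Q_mul hz,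
    show ∑ j, T.bCov j k x y * y j = T.b0Cov k x y from rfl]
  ring

theorem sum_gCov_mul' (T : LocalChange n) (x y : Coord n) (i j : Fin n) :
    ∑ k, T.gCov i j k x y * y k = T.K i j x y * T.σ0 x y + 2 * T.B i j x y * T.E00 x y +
      T.Q i x y * (T.E0 j x y + T.F0 j x y) + T.Q j x y * (T.E0 i x y + T.F0 i x y) := by
  rw [← sum_bCov_mul, ← sum_bCov_mul, ← sum_b0Cov_mul, σ0]
  simp only [Finset.mul_sum, ← Finset.sum_add_distrib]
  exact Finset.sum_congr rfl fun j _ => by rw [gCov]; ring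

/-- Contracting the lower index of `N̄ - N` leaves twice the spray difference, whereas contracting
an index of the Cartan tensor, as in `sum_C_f0_N'`, gives zero. This makes the system triangular. -/
theorem sum_C_f0_N (H : LocalHyp U Ω T) (hz : (x, y) ∈ U) (j k : Fin n) :
    ∑ i, (∑ s, C T.f0 j k s x y * (N T.f0 s i x y - N T.L s i x y)) * y i =
      2 * ∑ s, C T.f0 j k s x y * (G T.f0 s x y - G T.L s x y) := by
  simp only [Finset.sum_mul]
  rw [Finset.sum_comm, Finset.mul_sum]
  refine Finset.sum_congr rfl fun s _ => ?_
  simp only [mul_assoc, ← Finset.mul_sum, sub_mul, Finset.sum_sub_distrib,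
    H.fins.sum_N_mul hz, H.finsBar.sum_N_mul hz]
  ring

theorem sum_C_f0_N' (H : LocalHyp U Ω T) (hz : (x, y) ∈ U) (k r : Fin n) :
    ∑ i, (∑ s, C T.f0 i k s x y * (N T.f0 s r x y - N T.L s r x y)) * y i = 0 := by
  simp only [Finset.sum_mul]
  rw [Finset.sum_comm]
  refine Finset.sum_eq_zero fun s _ => ?_
  rw [Finset.sum_congr rfl fun i _ => mul_right_comm _ _ _, ← Finset.sum_mul,
    H.finsBar.sum_C_mul' hz, zero_mul]

/-- The difference of the Barthel connections, with its upper index lowered. -/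
theorem sum_g_f0_N_sub (H : LocalHyp U Ω T) (hz : (x, y) ∈ U) (r k : Fin n) :
    ∑ s, g T.f0 r s x y * (N T.f0 s k x y - N T.L s k x y) =
      (1 / 2) * (T.K r k x y * T.σ0 x y + T.Ky r x y * T.σLow k x y - T.Ky k x y * T.σLow r x y)
      + T.B r k x y * T.E00 x y + T.Q k x y * T.F0 r x y + T.Q r x y * T.E0 k x y
      + T.q x y * T.F r k x y
      - 2 * ∑ s, C T.f0 k r s x y * (G T.f0 s x y - G T.L s x y) := by
  -- Both connections satisfy `Γ^s_{jk} y^j = N^s_k`, so the lowered `Γ̄ - Γ` is contracted with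
  -- `y^j`.
  have h1 : ∑ s, g T.f0 r s x y * (N T.f0 s k x y - N T.L s k x y) =
      ∑ j, (∑ s, g T.f0 r s x y * (Gam T.f0 s j k x y - Gam T.L s j k x y)) * y j := by
    simp only [Finset.sum_mul]
    rw [Finset.sum_comm]
    refine Finset.sum_congr rfl fun s _ => ?_
    simp only [mul_assoc, ← Finset.mul_sum, sub_mul, Finset.sum_sub_distrib,
      H.fins.sum_Gam_mul hz, H.finsBar.sum_Gam_mul hz]
  rw [h1]
  simp only [H.sum_g_f0_Gam_sub hz]
  have h2 : ∀ j, (1 / 2) * (T.gCov k r j x y + T.gCov j r k x y - T.gCov j k r x y)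
      = (1 / 2) * (T.gCov k r j x y + T.gCov r j k x y - T.gCov k j r x y) := fun j => by
    rw [H.gCov_symm hz j r k, H.gCov_symm hz j k r]
  simp only [h2, add_mul, sub_mul, mul_assoc, Finset.sum_add_distrib, Finset.sum_sub_distrib,
    ← Finset.mul_sum, H.sum_gCov_mul hz, sum_gCov_mul', H.sum_C_f0_N hz, H.sum_C_f0_N' hz]
  rw [b0Cov_eq, b0Cov_eq, H.K_symm hz k r, H.B_symm hz k r, F]
  ring

/-- The difference of the sprays, with its index lowered. -/
theorem sum_g_f0_G_sub (H : LocalHyp U Ω T) (hz : (x, y) ∈ U) (r : Fin n) :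
    ∑ s, g T.f0 r s x y * (G T.f0 s x y - G T.L s x y) =
      (1 / 2) * (T.Ky r x y * T.σ0 x y + T.Q r x y * T.E00 x y
        - T.cG x y * T.L x y ^ 2 * T.σLow r x y) + T.q x y * T.F0 r x y := by
  have h1 : 2 * ∑ s, g T.f0 r s x y * (G T.f0 s x y - G T.L s x y) =
      ∑ k, (∑ s, g T.f0 r s x y * (N T.f0 s k x y - N T.L s k x y)) * y k := by
    simp only [Finset.sum_mul]
    rw [Finset.sum_comm, Finset.mul_sum]
    refine Finset.sum_congr rfl fun s _ => ?_
    simp only [mul_assoc, ← Finset.mul_sum, sub_mul, Finset.sum_sub_distrib,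
      H.fins.sum_N_mul hz, H.finsBar.sum_N_mul hz]
    ring
  -- The only term still containing the unknown disappears here, which makes the spray difference
  -- explicit.
  have h2 : ∑ k, (∑ s, C T.f0 k r s x y * (G T.f0 s x y - G T.L s x y)) * y k = 0 := by
    simp only [Finset.sum_mul]
    rw [Finset.sum_comm]
    refine Finset.sum_eq_zero fun s _ => ?_
    rw [Finset.sum_congr rfl fun i _ => mul_right_comm _ _ _, ← Finset.sum_mul,
      H.finsBar.sum_C_mul' hz, zero_mul]
  have h3 : ∀ k, ((1 / 2) * (T.K r k x y * T.σ0 x y + T.Ky r x y * T.σLow k x y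
      - T.Ky k x y * T.σLow r x y)
      + T.B r k x y * T.E00 x y + T.Q k x y * T.F0 r x y + T.Q r x y * T.E0 k x y
      + T.q x y * T.F r k x y
      - 2 * ∑ s, C T.f0 k r s x y * (G T.f0 s x y - G T.L s x y)) * y k =
      (1 / 2) * (T.σ0 x y * (T.K r k x y * y k) + T.Ky r x y * (T.σLow k x y * y k)
      - T.σLow r x y * (T.Ky k x y * y k))
      + T.E00 x y * (T.B r k x y * y k) + T.F0 r x y * (T.Q k x y * y k)
      + T.Q r x y * (T.E0 k x y * y k) + T.q x y * (T.F r k x y * y k)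
      - 2 * ((∑ s, C T.f0 k r s x y * (G T.f0 s x y - G T.L s x y)) * y k) := fun k => by ring
  simp only [H.sum_g_f0_N_sub hz, h3, Finset.sum_add_distrib, Finset.sum_sub_distrib,
    ← Finset.mul_sum, H.sum_K_mul hz, H.sum_Ky_mul hz, H.sum_B_mul hz, H.sum_Q_mul hz, h2] at h1
  rw [show ∑ k, T.σLow k x y * y k = T.σ0 x y from rfl,
    show ∑ k, T.E0 k x y * y k = T.E00 x y from rfl,
    show ∑ k, T.F r k x y * y k = T.F0 r x y from rfl] at h1
  linear_combination (1 / 2) * h1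

/-- The difference of the sprays. -/
theorem G_f0_sub (H : LocalHyp U Ω T) (hz : (x, y) ∈ U) (i : Fin n) :
    G T.f0 i x y - G T.L i x y = T.Dspray i x y := by
  rw [H.sum_newInv_g_f0 hz (X := fun s => G T.f0 s x y - G T.L s x y) (H.sum_g_f0_G_sub hz) i,
    newInv_mul]
  have h1 : ∀ Z : Fin n → ℝ, ∑ r, Z r * ((1 / 2) * (T.Ky r x y * T.σ0 x y + T.Q r x y * T.E00 x y
        - T.cG x y * T.L x y ^ 2 * T.σLow r x y) + T.q x y * T.F0 r x y) =
      T.σ0 x y * (T.cG x y * ∑ r, Z r * yLow T.L r x y +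
        T.L x y ^ 2 * T.cBY x y / 2 * ∑ r, Z r * T.m r x y) +
      T.E00 x y / 2 * (T.cBY x y * ∑ r, Z r * yLow T.L r x y + T.p0 x y * ∑ r, Z r * T.b r x)
      - T.cG x y * T.L x y ^ 2 / 2 * ∑ r, Z r * T.σLow r x y
      + T.q x y * ∑ r, Z r * T.F0 r x y := by
    intro Z
    simp only [Finset.mul_sum, ← Finset.sum_add_distrib, ← Finset.sum_sub_distrib]
    exact Finset.sum_congr rfl fun r _ => by rw [Ky, Q, cBY]; ring
  have h2 : ∀ Z : Fin n → ℝ, ∑ r, ((1 / 2) * (T.Ky r x y * T.σ0 x y + T.Q r x y * T.E00 x y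
        - T.cG x y * T.L x y ^ 2 * T.σLow r x y) + T.q x y * T.F0 r x y) * Z r =
      T.σ0 x y * (T.cG x y * ∑ r, yLow T.L r x y * Z r +
        T.L x y ^ 2 * T.cBY x y / 2 * ∑ r, T.m r x y * Z r) +
      T.E00 x y / 2 * (T.cBY x y * ∑ r, yLow T.L r x y * Z r + T.p0 x y * ∑ r, T.b r x * Z r)
      - T.cG x y * T.L x y ^ 2 / 2 * ∑ r, T.σLow r x y * Z r
      + T.q x y * ∑ r, T.F0 r x y * Z r := by
    intro Z
    simp only [mul_comm _ (Z _), h1]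
  rw [h1, h2, h2, H.raise_yLow hz, H.raise_m hz, H.sum_yLow_bUp hz, H.sum_m_bUp hz,
    sum_b_mul_bUp, H.fins.sum_yLow_mul hz, H.sum_m_mul hz, sum_F0_mul,
    show ∑ r, gInv T.L i r x y * T.b r x = T.bUp i x y from rfl,
    show ∑ r, gInv T.L i r x y * T.σLow r x y = T.σUp i x y from rfl,
    show ∑ r, gInv T.L i r x y * T.F0 r x y = T.F0Up i x y from rfl,
    show ∑ r, T.σLow r x y * T.bUp r x y = T.σβ x y from rfl,
    show ∑ r, T.F0 r x y * T.bUp r x y = T.Fβ0 x y from rfl,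
    show ∑ r, T.b r x * y r = T.β x y from rfl,
    show ∑ r, T.σLow r x y * y r = T.σ0 x y from rfl]
  have h0 := H.L_ne hz
  have hp := H.p_ne hz
  have hs : T.eσ x y ≠ 0 := eσ_ne
  have hP := H.cG_ne hz
  have hε := H.ε_ne hz
  have e4 := H.ε_eq hz
  have e5 := H.bSq_eq hz
  -- `e^σ` and `p₋₁` are traded for `cG`, `cBY` and `p`. Eliminating `f²` and `q` by homogeneity
  -- then leaves the formula for `ε` as the only relation needed.
  have hc : T.eσ x y = T.cG x y / T.p x y := by rw [cG]; field_simp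
  have hd : T.pm1 x y = T.cBY x y * T.p x y / T.cG x y := by
    rw [cG, cBY]; field_simp
  rw [Dspray, hd, hc, H.s0_eq hz, H.sm1_eq hz, H.sm2_eq hz, e5]
  rw [← H.cG_mul hz, ← H.cBY_mul hz] at e4 ⊢
  generalize T.ε x y = ε at *
  field_simp at e4 ⊢
  linear_combination (T.L x y ^ 2 * T.E00 x y * (y i * T.cBY x y + T.bUp i x y * T.p0 x y) +
    T.L x y ^ 4 * T.σ0 x y * T.cBY x y * T.bUp i x y) * e4

end LocalHyp

/-! ### Solving for the Barthel and Cartan connections. -/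

namespace LocalHyp

open LocalChange

variable {n : ℕ} {U : Set (Coord n × Coord n)} {Ω : Set (ℝ × ℝ)} {T : LocalChange n}
  {x y : Coord n}

/-- The tensor `A` is the lowered difference of the Barthel connections from `sum_g_f0_N_sub`, with
the spray difference replaced by `Dspray`. -/
theorem A_eq (H : LocalHyp U Ω T) (hz : (x, y) ∈ U) (r k : Fin n) :
    T.A r k x y =
      (1 / 2) * (T.K r k x y * T.σ0 x y + T.Ky r x y * T.σLow k x y - T.Ky k x y * T.σLow r x y)
      + T.B r k x y * T.E00 x y + T.Q k x y * T.F0 r x y + T.Q r x y * T.E0 k x y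
      + T.q x y * T.F r k x y
      - 2 * ∑ s, C T.f0 k r s x y * (G T.f0 s x y - G T.L s x y) := by
  have h0 := H.L_ne hz
  have h1 : ∑ s, C T.f0 k r s x y * (G T.f0 s x y - G T.L s x y) =
      ∑ s, (T.eσ x y * T.p x y * C T.L s r k x y + T.V s r k x y) * T.Dspray s x y :=
    Finset.sum_congr rfl fun s _ => by
      rw [H.G_f0_sub hz, H.finsBar.C_swap₁₃ hz k r s, H.C_f0 hz, cG]
  rw [h1, A, K, show T.A4 x y = T.cYY x y - T.β x y ^ 3 / T.L x y ^ 4 * T.p02 x y from rfl,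
    H.cYY_eq hz, B, H.fins.h_eq hz]
  simp only [A1, A2, A3, Ky, m, cG, cBY]
  field_simp
  ring

/-- This is the contraction with `y^r` that arises when `newInv` is applied to `A`; it accounts for
the last bracket of `Dnonlin`. -/
theorem sum_A_mul (H : LocalHyp U Ω T) (hz : (x, y) ∈ U) (k : Fin n) :
    ∑ r, T.A r k x y * y r = T.q x y * T.b0Cov k x y + T.cG x y * T.L x y ^ 2 * T.σLow k x y := by
  have h2 : ∑ r, (∑ s, C T.f0 k r s x y * (G T.f0 s x y - G T.L s x y)) * y r = 0 := by
    simp only [Finset.sum_mul]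
    rw [Finset.sum_comm]
    refine Finset.sum_eq_zero fun s _ => ?_
    rw [Finset.sum_congr rfl fun r _ => mul_right_comm _ _ _, ← Finset.sum_mul,
      Finset.sum_congr rfl fun r _ => by rw [H.finsBar.C_swap₁₂ hz k r s],
      H.finsBar.sum_C_mul' hz, zero_mul]
  have h3 : ∑ r, T.F r k x y * y r = -T.F0 k x y := by
    rw [F0, ← Finset.sum_neg_distrib]
    exact Finset.sum_congr rfl fun r _ => by rw [F, F]; ring
  have h4 : ∀ r, ((1 / 2) * (T.K r k x y * T.σ0 x y + T.Ky r x y * T.σLow k x y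
      - T.Ky k x y * T.σLow r x y)
      + T.B r k x y * T.E00 x y + T.Q k x y * T.F0 r x y + T.Q r x y * T.E0 k x y
      + T.q x y * T.F r k x y
      - 2 * ∑ s, C T.f0 k r s x y * (G T.f0 s x y - G T.L s x y)) * y r =
      (1 / 2) * (T.σ0 x y * (T.K k r x y * y r) + T.σLow k x y * (T.Ky r x y * y r)
      - T.Ky k x y * (T.σLow r x y * y r))
      + T.E00 x y * (T.B k r x y * y r) + T.Q k x y * (T.F0 r x y * y r)
      + T.E0 k x y * (T.Q r x y * y r) + T.q x y * (T.F r k x y * y r)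
      - 2 * ((∑ s, C T.f0 k r s x y * (G T.f0 s x y - G T.L s x y)) * y r) := fun r => by
    rw [H.K_symm hz r k, H.B_symm hz r k]
    ring
  simp only [H.A_eq hz, h4, Finset.sum_add_distrib, Finset.sum_sub_distrib,
    ← Finset.mul_sum, H.sum_K_mul hz, H.sum_Ky_mul hz, H.sum_B_mul hz, H.sum_Q_mul hz, h2, h3,
    sum_F0_mul, b0Cov_eq]
  rw [show ∑ k, T.σLow k x y * y k = T.σ0 x y from rfl]
  ring

/-- The difference of the Barthel connections. -/
theorem N_f0_sub (H : LocalHyp U Ω T) (hz : (x, y) ∈ U) (i k : Fin n) :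
    N T.f0 i k x y - N T.L i k x y = T.Dnonlin i k x y := by
  rw [H.sum_newInv_g_f0 hz (X := fun s => N T.f0 s k x y - N T.L s k x y)
    (fun r => (H.sum_g_f0_N_sub hz r k).trans (H.A_eq hz r k).symm) i, newInv_mul,
    H.sum_A_mul hz, Dnonlin]
  have h1 : ∑ r, gInv T.L i r x y * T.A r k x y = T.AUp i k x y :=
    Finset.sum_congr rfl fun r _ => by rw [H.fins.gInv_symm hz]
  rw [h1, cG, mul_inv, div_eq_mul_inv]
  ring

/-- The difference of the Cartan connections. -/
theorem Gam_f0 (H : LocalHyp U Ω T) (hz : (x, y) ∈ U) (i j k : Fin n) :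
    Gam T.f0 i j k x y = Gam T.L i j k x y + T.Dten i j k x y := by
  rw [← sub_eq_iff_eq_add', H.sum_newInv_g_f0 hz
    (X := fun s => Gam T.f0 s j k x y - Gam T.L s j k x y)
    (fun r => H.sum_g_f0_Gam_sub hz r j k) i, Dten]
  refine Finset.sum_congr rfl fun r _ => ?_
  -- With `D^m_r` recognised as `N̄ - N`, the terms in `C` and `V` combine into the new Cartan
  -- tensor.
  have h1 : ∀ j k r, T.thetaArg j k r x y =
      2 * ∑ s, C T.f0 j k s x y * (N T.f0 s r x y - N T.L s r x y)
      - T.K j k x y * T.σLow r x y - 2 * T.B j k x y * T.b0Cov r x y := by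
    intro j k r
    simp only [thetaArg, H.N_f0_sub hz, H.C_f0 hz, add_mul, Finset.sum_add_distrib, mul_assoc,
      ← Finset.mul_sum, cG]
    ring
  have h2 : ∑ s, C T.f0 r j s x y * (N T.f0 s k x y - N T.L s k x y) =
      ∑ s, C T.f0 j r s x y * (N T.f0 s k x y - N T.L s k x y) :=
    Finset.sum_congr rfl fun s _ => by rw [H.finsBar.C_swap₁₂ hz]
  simp only [Theta, h1, h2, gCov, H.K_symm hz r j, H.B_symm hz r j, F, E]
  ring

end LocalHyp

/-! ## From the manifold to local coordinates -/

section Manifold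

variable {n : ℕ} {M : Type*} [TopologicalSpace M] [ChartedSpace (Coord n) M]

theorem tangentVec_smul (φ : OpenPartialHomeomorph M (Coord n)) (c : ℝ) (x y : Coord n) :
    tangentVec φ x (c • y) = scale c (tangentVec φ x y) := by
  simp only [tangentVec, scale]
  congr 1
  exact map_smul (mfderiv (𝓡 n) (𝓡 n) φ.symm x) c y

/-- Linearity of the form and of the chart derivative: the local `β` is the value of the form on the
tangent vector, so the change is the same on the manifold and in coordinates. -/
theorem locForm_sum (φ : OpenPartialHomeomorph M (Coord n))
    (β : (x : M) → TangentSpace (𝓡 n) x →L[ℝ] ℝ) (x y : Coord n) :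
    ∑ i, locForm φ β i x * y i = β (tangentVec φ x y).proj (tangentVec φ x y).snd := by
  let l : Coord n →L[ℝ] ℝ := (β (φ.symm x)).comp (mfderiv (𝓡 n) (𝓡 n) φ.symm x)
  have h1 : y = ∑ i, y i • basisVec i := by
    ext j
    simp [basisVec_apply]
  have h2 : l y = ∑ i, y i * l (basisVec i) := by
    conv_lhs => rw [h1]
    simp [map_sum]
  exact (Finset.sum_congr rfl fun i _ => mul_comm _ _).trans h2.symm

theorem locFun_changed (φ : OpenPartialHomeomorph M (Coord n)) (L : TangentBundle (𝓡 n) M → ℝ)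
    (σ : M → ℝ) (β : (x : M) → TangentSpace (𝓡 n) x →L[ℝ] ℝ) (f : ℝ → ℝ → ℝ) :
    locFun φ (changed L σ β f) = (localChange φ L σ β f).f0 := by
  funext x y
  change f _ _ = f _ _
  congr 1
  exact (locForm_sum φ β x y).symm

/-- Euler's theorem for functions that are positively homogeneous of degree one in `y`. -/
theorem eulerOn_of_homog {U : Set (Coord n × Coord n)} {F : LocFun n} (hU : IsOpen U)
    (hF : SmoothOn U F)
    (h : ∀ x y, (x, y) ∈ U → ∀ c : ℝ, 0 < c → F x (c • y) = c * F x y) : EulerOn U 1 F := by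
  intro x y hz
  have hd := (hF.differentiableAt hU hz).hasFDerivAt
  -- `c ↦ F(x, c y)` is differentiated at `c = 1` twice: by the chain rule, and by homogeneity,
  -- which holds for all `c` near `1`.
  have h1 : HasDerivAt (fun c : ℝ => (x, c • y)) ((0 : Coord n), y) 1 := by
    simpa using (hasDerivAt_const (1 : ℝ) x).prodMk ((hasDerivAt_id (1 : ℝ)).smul_const y)
  have h2 : HasDerivAt (fun c : ℝ => F x (c • y))
      (fderiv ℝ (fun z : Coord n × Coord n => F z.1 z.2) (x, y) (0, y)) 1 :=
    HasFDerivAt.comp_hasDerivAt (f := fun c : ℝ => (x, c • y))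
      (l := fun z : Coord n × Coord n => F z.1 z.2) 1 (by simpa using hd) h1
  have h3 : HasDerivAt (fun c : ℝ => F x (c • y)) (F x y) 1 := by
    have h4 : HasDerivAt (fun c : ℝ => c * F x y) (1 * F x y) 1 :=
      (hasDerivAt_id (1 : ℝ)).mul_const _
    rw [one_mul] at h4
    refine h4.congr_of_eventuallyEq ?_
    filter_upwards [lt_mem_nhds one_pos] with c hc using h x y hz c hc
  rw [one_mul, ← h2.unique h3]
  have h5 : ((0 : Coord n), y) = ∑ i, y i • ((0 : Coord n), basisVec i) := by
    refine Prod.ext ?_ ?_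
    · simp [Prod.fst_sum]
    · ext j
      simp [Prod.snd_sum, basisVec_apply]
  conv_rhs => rw [h5]
  rw [map_sum]
  exact Finset.sum_congr rfl fun i _ => by
    rw [map_smul, (hF.hasPd_dy hU hz i).2.symm, pd, smul_eq_mul]

theorem IsFinsler.localFinsler {A : Set (TangentBundle (𝓡 n) M)} (hA : IsConicDomain A)
    {L : TangentBundle (𝓡 n) M → ℝ} (hL : IsFinsler A L)
    {φ : OpenPartialHomeomorph M (Coord n)} (hφ : φ ∈ IsManifold.maximalAtlas (𝓡 n) ∞ M) :
    LocalFinsler (locDom φ A) (locFun φ L) where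
  isOpen := hA.isOpen φ hφ
  smooth := hL.smooth φ hφ
  pos _ _ hz := hL.pos _ hz.2
  euler := eulerOn_of_homog (hA.isOpen φ hφ) (hL.smooth φ hφ) fun x y hz c hc => by
    rw [locFun, tangentVec_smul, hL.homog _ hz.2 c hc, locFun]
  det_ne := hL.nondeg φ hφ

theorem IsHomogOn.eulerOn₂ {f : ℝ → ℝ → ℝ} {Ω : Set (ℝ × ℝ)} (hf : IsHomogOn f Ω) :
    EulerOn₂ Ω 1 f := by
  intro u v hw
  have hF : SmoothOn Ω f := hf.smooth
  have hd := (hF.differentiableAt hf.isOpen hw).hasFDerivAt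
  have h1 : HasDerivAt (fun c : ℝ => (c * u, c * v)) (u, v) 1 := by
    simpa using ((hasDerivAt_id (1 : ℝ)).mul_const u).prodMk ((hasDerivAt_id (1 : ℝ)).mul_const v)
  have h2 : HasDerivAt (fun c : ℝ => f (c * u) (c * v))
      (fderiv ℝ (fun z : ℝ × ℝ => f z.1 z.2) (u, v) (u, v)) 1 :=
    HasFDerivAt.comp_hasDerivAt (f := fun c : ℝ => (c * u, c * v))
      (l := fun z : ℝ × ℝ => f z.1 z.2) 1 (by simpa using hd) h1
  have h3 : HasDerivAt (fun c : ℝ => f (c * u) (c * v)) (f u v) 1 := by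
    have h4 : HasDerivAt (fun c : ℝ => c * f u v) (1 * f u v) 1 :=
      (hasDerivAt_id (1 : ℝ)).mul_const _
    rw [one_mul] at h4
    refine h4.congr_of_eventuallyEq ?_
    filter_upwards [lt_mem_nhds one_pos] with c hc using hf.homog u v hw c hc
  rw [one_mul, ← h2.unique h3]
  have h5 : ((u, v) : ℝ × ℝ) = u • (1, 0) + v • (0, 1) := by simp
  conv_rhs => rw [h5]
  rw [map_add, map_smul, map_smul, ← (hF.hasPd_D1 hf.isOpen hw).2,
    ← (hF.hasPd_D2 hf.isOpen hw).2, smul_eq_mul, smul_eq_mul]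
  simp [pd]

theorem localHyp [IsManifold (𝓡 n) ∞ M]
    {A : Set (TangentBundle (𝓡 n) M)} (hA : IsConicDomain A)
    {L : TangentBundle (𝓡 n) M → ℝ} (hL : IsFinsler A L)
    {σ : M → ℝ} (hσ : ContMDiff (𝓡 n) 𝓘(ℝ, ℝ) ∞ σ)
    {β : (x : M) → TangentSpace (𝓡 n) x →L[ℝ] ℝ} (hβ : IsSmoothForm β)
    {f : ℝ → ℝ → ℝ} {Ω : Set (ℝ × ℝ)} (hf : IsHomogOn f Ω)
    (hΩ : ∀ v ∈ A, (Real.exp (σ v.proj) * L v, β v.proj v.snd) ∈ Ω)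
    (hLbar : IsFinsler A (changed L σ β f))
    (hf₁ : ∀ v ∈ A, D1 f (Real.exp (σ v.proj) * L v) (β v.proj v.snd) ≠ 0)
    {φ : OpenPartialHomeomorph M (Coord n)} (hφ : φ ∈ IsManifold.maximalAtlas (𝓡 n) ∞ M) :
    LocalHyp (locDom φ A) Ω (localChange φ L σ β f) where
  fins := hL.localFinsler hA hφ
  finsBar := locFun_changed φ L σ β f ▸ hLbar.localFinsler hA hφ
  smooth_σ := by
    have h1 : ContDiffOn ℝ ∞ (fun x => σ (φ.symm x)) φ.target :=
      (hσ.comp_contMDiffOn (contMDiffOn_symm_of_mem_maximalAtlas hφ)).contDiffOn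
    exact h1.comp contDiffOn_fst fun z hz => hz.1
  smooth_b i := (hβ φ hφ i).comp contDiffOn_fst fun z hz => hz.1
  isOpen := hf.isOpen
  smooth_f := hf.smooth
  euler_f := hf.eulerOn₂
  maps x y hz := by
    have h1 : (localChange φ L σ β f).β x y = _ := locForm_sum φ β x y
    rw [h1]
    exact hΩ _ hz.2
  f1_ne x y hz := by
    have h1 : (localChange φ L σ β f).β x y = _ := locForm_sum φ β x y
    rw [LocalChange.f1, LocalChange.ev, h1]
    exact hf₁ _ hz.2

end Manifold

end GenBetaConformal

end

open GenBetaConformal in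
theorem mainTheorem1 {n : ℕ} {M : Type*} [TopologicalSpace M] [ChartedSpace (Coord n) M]
    [IsManifold (𝓡 n) ∞ M]
    (A : Set (TangentBundle (𝓡 n) M)) (hA : IsConicDomain A)
    (L : TangentBundle (𝓡 n) M → ℝ) (hL : IsFinsler A L)
    (σ : M → ℝ) (hσ : ContMDiff (𝓡 n) 𝓘(ℝ, ℝ) ∞ σ)
    (β : (x : M) → TangentSpace (𝓡 n) x →L[ℝ] ℝ) (hβ : IsSmoothForm β)
    (f : ℝ → ℝ → ℝ) (Ω : Set (ℝ × ℝ)) (hf : IsHomogOn f Ω)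
    (hΩ : ∀ v ∈ A, (Real.exp (σ v.proj) * L v, β v.proj v.snd) ∈ Ω)
    (hLbar : IsFinsler A (changed L σ β f))
    (hf₁ : ∀ v ∈ A, D1 f (Real.exp (σ v.proj) * L v) (β v.proj v.snd) ≠ 0)
    (φ : OpenPartialHomeomorph M (Coord n)) (hφ : φ ∈ IsManifold.maximalAtlas (𝓡 n) ∞ M)
    (x y : Coord n) (hxy : (x, y) ∈ locDom φ A) :
    (∀ i j k : Fin n,
      Gam (locFun φ (changed L σ β f)) i j k x y =
        Gam (locFun φ L) i j k x y + (localChange φ L σ β f).Dten i j k x y) ∧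
    (∀ i r : Fin n,
      gInv (locFun φ (changed L σ β f)) i r x y =
        (localChange φ L σ β f).newInv i r x y) := by
  have H := localHyp hA hL hσ hβ hf hΩ hLbar hf₁ hφ
  rw [locFun_changed]
  exact ⟨fun i j k => H.Gam_f0 hxy i j k, fun i r => H.gInv_f0 hxy i r⟩
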